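/- Let $G>0$. Consider the four-dimensional theory of a metric $g_{\mu\nu}$, a gauge field $A_\mu$ with $F=\mathrm dA$, and a dilaton $\phi$ with Lagrangian $$\mathcal L=\frac{1}{16\pi G}\big(R-e^{-2\phi}F_{\mu\nu}F^{\mu\nu}-2\nabla_\mu\phi\nabla^\mu\phi\big).$$ For parameters $p=(m,q,\phi_\infty)$ in the domain $D=\{m>0,\ q^2<2m^2\}$ put $\Sigma=-q^2/(2m)$, $r_0=m+\Sigma$, $r_\pm=m\pm r_0$, $f=\frac{(r-r_+)(r-r_-)}{r^2-\Sigma^2}$ and $$\mathrm ds^2=-f\,\mathrm dt^2+\frac{\mathrm dr^2}{f}+(r^2-\Sigma^2)(\mathrm d\theta^2+\sin^2\theta\,\mathrm d\varphi^2),\quad A=\frac{q\,e^{\phi_\infty}}{r-\Sigma}\,\mathrm dt,\quad \phi=\tfrac12\log\frac{r+\Sigma}{r-\Sigma}+\phi_\infty .$$ For a generator $\epsilon=\{\xi^\mu,\lambda\}$ (a vector field and a gauge parameter, acting by $\delta_\epsilon\Phi=\mathscr L_\xi\Phi+\delta_\lambda\Phi$, $\delta_\lambda A_\mu=\partial_\mu\lambda$)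 and a field variation $\delta\Phi$, the charge variation is $\delta H_\epsilon=\oint k_\epsilon(\delta\Phi;\Phi)$ with $k_\epsilon=\delta Q_\epsilon-\xi\cdot\Theta(\delta\Phi,\Phi)$ and $\delta\epsilon=0$. In components (densities including $\sqrt{-g}$), $k_\epsilon^{\mu\nu}=\delta Q_\epsilon^{\mu\nu}+\xi^\mu\Theta^\nu-\xi^\nu\Theta^\mu$ with $$\Theta^\mu=\tfrac{\sqrt{-g}}{16\pi G}\big(g^{\alpha\beta}\delta\Gamma^\mu_{\alpha\beta}-g^{\alpha\mu}\delta\Gamma^\beta_{\alpha\beta}-4e^{-2\phi}F^{\mu\nu}\delta A_\nu-4\nabla^\mu\phi\,\delta\phi\big),$$ $$Q_\epsilon^{\mu\nu}=\tfrac{\sqrt{-g}}{16\pi G}\big(\nabla^\nu\xi^\mu-\nabla^\mu\xi^\nu-4e^{-2\phi}F^{\mu\nu}(\xi^\alpha A_\alpha+\lambda)\big),$$ and over a sphere of constant $t,r$ the charge variation is $\int_0^{\pi}\!\int_0^{2\pi}k_\epsilon^{tr}\,\mathrm d\varphi\,\mathrm d\theta$. Let $\hat\delta M,\hat\delta Q,\hat\delta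 S$ be the charge variations, for the parametric field variations $\hat\delta\Phi=\sum_i\frac{\partial\Phi}{\partial p_i}\delta p_i$, of the generators $\eta_M=\{\partial_t,0\}$, $\eta_Q=\{0,1\}$, $\eta_S=\frac{2\pi}{\kappa_H}\{\partial_t,-\varPhi_H\}$, where $\varPhi_H=\frac{q e^{\phi_\infty}}{2m}$ and $\kappa_H=\frac1{4m}$. Then: 1. For every $p\in D$ the fields solve the field equations of $\mathcal L$ in the region $r>r_+$; $\phi\to\phi_\infty$ at infinity; $\partial_t$ is timelike for $r>r_+$ and becomes null at the horizon $r=r_+$; the angular velocities at the horizon and at infinity and the electric potential $\varPhi_\infty$ at infinity vanish; the electric potential and the surface gravity at the horizon are $\varPhi_H$ and $\kappa_H$; and $\eta_M,\eta_Q,\eta_S$ are exact symmetries, i.e. $\delta_\eta\Phi=0$. 2. On every sphere of constant $t$ and constant $r>r_+$, $$\hat\delta M=\frac{\delta m}{G}-\frac{q^2}{2Gm}\delta\phi_\infty,\qquad \hat\delta Q=\frac{e^{-\phi_\infty}}{G}(\delta q-q\,\delta\phi_\infty),\qquad \hat\delta S=\frac{8\pi m\,\delta m-4\pi q\,\delta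 q}{G}.$$ 3. Call a one-form on parameter space integrable on an open set $U\subseteq D$ for a linear space $V$ of parameter variations if it is, at the points of $U$ and along the translates of $V$, the differential of a function of the parameters. For every nonempty open $U\subseteq D$ and every $V\subseteq\mathbb R^3$ of dimension at least $2$, $\hat\delta M$ is integrable on $U$ for $V$ if and only if $\delta\phi_\infty=0$ on $V$. In particular $\hat\delta M$ is not integrable on $U$ when all three parameters vary, and $\phi_\infty$ is the only one of the three parameters such that setting its variation to zero makes $\hat\delta M,\hat\delta Q,\hat\delta S$ all integrable; so $\phi_\infty$ is redundant. 4. The charge variations integrate to $$M=\frac mG,\qquad Q=\frac{q\,e^{-\phi_\infty}}{G},\qquad S=\frac{\pi(4m^2-2q^2)}{G}$$ on $D$ ($M$ for variations with $\delta\phi_\infty=0$, $Q$ and $S$ for all variations). 5. With $T_H=\kappa_H/2\pi$, $T_H\hat\delta S=\hat\delta M-\varPhi_H\hat\delta Q$ for all parametric variations, and the integrated charges satisfy the first law $T_H\,\delta S=\delta M-\varPhi_H\,\delta Q$ for all variations with $\delta\phi_\infty=0$, without any $\delta\phi_\infty$ term. -/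

import Mathlib

open Filter Topology

noncomputable section

namespace EMD

/-! ## Coordinate calculus -/

/-- The partial derivative `∂f/∂xᵢ` at `x`. -/
def pd {n : ℕ} (i : Fin n) (f : (Fin n → ℝ) → ℝ) (x : Fin n → ℝ) : ℝ :=
  deriv (fun s => f (Function.update x i s)) (x i)

/-- A point of a four-dimensional coordinate chart. For the black hole the coordinates are
`x 0 = t`, `x 1 = r`, `x 2 = θ`, `x 3 = φ` (azimuth). -/
abbrev Pt := Fin 4 → ℝ

/-- The dynamical fields: metric `g_{μν}`, gauge field `A_μ` and dilaton. The same type is used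
for field variations `δΦ = (δg_{μν}, δA_μ, δφ)`. -/
structure Fields where
  g : Pt → Matrix (Fin 4) (Fin 4) ℝ
  A : Pt → Fin 4 → ℝ
  dil : Pt → ℝ

/-- The field configuration `Φ + s δΦ`. -/
def Fields.along (F dF : Fields) (s : ℝ) : Fields where
  g := fun x => F.g x + s • dF.g x
  A := fun x => F.A x + s • dF.A x
  dil := fun x => F.dil x + s * dF.dil x

/-- The first variation `δW` of a functional `W` of the fields at `Φ` in the direction `δΦ`. -/
def vary (W : Fields → ℝ) (F dF : Fields) : ℝ :=
  deriv (fun s => W (F.along dF s)) 0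

/-- The inverse metric `g^{μν}`. -/
def ginv (F : Fields) (x : Pt) : Matrix (Fin 4) (Fin 4) ℝ := (F.g x)⁻¹

/-- The volume density `√(-det g)`. -/
def vol (F : Fields) (x : Pt) : ℝ := Real.sqrt (-(F.g x).det)

/-- The Christoffel symbol `Γ^μ_{αβ}` of the Levi-Civita connection. -/
def Gam (F : Fields) (x : Pt) (μ α β : Fin 4) : ℝ :=
  (1 / 2) * ∑ ν, ginv F x μ ν *
    (pd α (fun y => F.g y ν β) x + pd β (fun y => F.g y ν α) x - pd ν (fun y => F.g y α β) x)

/-- The Ricci tensor `R_{αβ}`. -/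
def Ric (F : Fields) (x : Pt) (α β : Fin 4) : ℝ :=
  ∑ μ, (pd μ (fun y => Gam F y μ α β) x - pd β (fun y => Gam F y μ α μ) x
    + ∑ ν, (Gam F x μ μ ν * Gam F x ν α β - Gam F x μ β ν * Gam F x ν α μ))

/-- The scalar curvature `R`. -/
def scalarCurv (F : Fields) (x : Pt) : ℝ := ∑ α, ∑ β, ginv F x α β * Ric F x α β

/-- The field strength `F_{μν} = ∂_μ A_ν - ∂_ν A_μ`. -/
def Fdown (F : Fields) (x : Pt) (μ ν : Fin 4) : ℝ :=
  pd μ (fun y => F.A y ν) x - pd ν (fun y => F.A y μ) x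

/-- The field strength with raised indices, `F^{μν}`. -/
def Fup (F : Fields) (x : Pt) (μ ν : Fin 4) : ℝ :=
  ∑ α, ∑ β, ginv F x μ α * ginv F x ν β * Fdown F x α β

/-- `F_{μν} F^{μν}`. -/
def Fsq (F : Fields) (x : Pt) : ℝ := ∑ μ, ∑ ν, Fdown F x μ ν * Fup F x μ ν

/-- The gradient `∇^μ φ` of the dilaton. -/
def gradDil (F : Fields) (x : Pt) (μ : Fin 4) : ℝ := ∑ ν, ginv F x μ ν * pd ν F.dil x

/-! ## Einstein-Maxwell-dilaton theory -/

/-- The Lagrangian `(R - e^{-2φ} F_{μν}F^{μν} - 2 ∇_μφ ∇^μφ) / (16πG)`. -/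
def lagrangian (G : ℝ) (F : Fields) (x : Pt) : ℝ :=
  1 / (16 * Real.pi * G) * (scalarCurv F x - Real.exp (-2 * F.dil x) * Fsq F x
    - 2 * ∑ μ, pd μ F.dil x * gradDil F x μ)

/-- The Euler-Lagrange equations of `lagrangian G` on a region `U`, with respect to the metric,
the gauge field and the dilaton. -/
structure IsSolution (G : ℝ) (F : Fields) (U : Set Pt) : Prop where
  metric : ∀ x ∈ U, ∀ μ ν,
    1 / (16 * Real.pi * G) * (Ric F x μ ν
      - 2 * Real.exp (-2 * F.dil x) * (∑ α, ∑ β, ginv F x α β * Fdown F x μ α * Fdown F x ν β)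
      - 2 * pd μ F.dil x * pd ν F.dil x)
    - 1 / 2 * F.g x μ ν * lagrangian G F x = 0
  gauge : ∀ x ∈ U, ∀ ν,
    ∑ μ, pd μ (fun y => vol F y * Real.exp (-2 * F.dil y) * Fup F y μ ν) x = 0
  dilaton : ∀ x ∈ U,
    ∑ μ, pd μ (fun y => vol F y * gradDil F y μ) x
      + 1 / 2 * vol F x * Real.exp (-2 * F.dil x) * Fsq F x = 0

/-! ## Covariant phase space: charge variations -/

/-- A generator `ε = {ξ^μ, λ}`: a vector field together with a gauge parameter. -/
structure Gen where
  xi : Pt → Fin 4 → ℝ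
  lam : Pt → ℝ

/-- The transformation `δ_ε Φ = ℒ_ξ Φ + δ_λ Φ`, where `δ_λ A_μ = ∂_μ λ`. -/
def gaugeVar (F : Fields) (ε : Gen) : Fields where
  g := fun x => Matrix.of fun μ ν => ∑ α, (ε.xi x α * pd α (fun y => F.g y μ ν) x
    + F.g x α ν * pd μ (fun y => ε.xi y α) x + F.g x μ α * pd ν (fun y => ε.xi y α) x)
  A := fun x μ => (∑ α, (ε.xi x α * pd α (fun y => F.A y μ) x
    + F.A x α * pd μ (fun y => ε.xi y α) x)) + pd μ ε.lam x
  dil := fun x => ∑ α, ε.xi x α * pd α F.dil x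

/-- `ε` is an exact symmetry of `Φ` on the region `U`: `δ_ε Φ = 0` there. -/
def IsExactSymmetry (F : Fields) (ε : Gen) (U : Set Pt) : Prop :=
  ∀ x ∈ U, (gaugeVar F ε).g x = 0 ∧ (gaugeVar F ε).A x = 0 ∧ (gaugeVar F ε).dil x = 0

/-- The presymplectic potential `Θ^μ(δΦ, Φ)`, as a vector density (the factor `√(-g)` is
included): the surface term in `δ(√(-g) L) = E δΦ + ∂_μ Θ^μ`, namely
`√(-g)/(16πG) (g^{αβ} δΓ^μ_{αβ} - g^{αμ} δΓ^β_{αβ} - 4 e^{-2φ} F^{μν} δA_ν - 4 ∇^μφ δφ)`. -/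
def Theta (G : ℝ) (F dF : Fields) (x : Pt) (μ : Fin 4) : ℝ :=
  vol F x / (16 * Real.pi * G) *
    ((∑ α, ∑ β, (ginv F x α β * vary (fun H => Gam H x μ α β) F dF
        - ginv F x α μ * vary (fun H => Gam H x β α β) F dF))
      - 4 * Real.exp (-2 * F.dil x) * (∑ ν, Fup F x μ ν * dF.A x ν)
      - 4 * gradDil F x μ * dF.dil x)

/-- `∇_α ξ^β`. -/
def covDeriv (F : Fields) (xi : Pt → Fin 4 → ℝ) (x : Pt) (α β : Fin 4) : ℝ :=
  pd α (fun y => xi y β) x + ∑ ν, Gam F x β α ν * xi x ν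

/-- The Noether charge density `Q_ε^{μν}`, the antisymmetric potential of the Noether current:
on shell, `Θ^μ(δ_ε Φ, Φ) - ξ^μ √(-g) L = ∂_ν Q_ε^{μν}`. Explicitly it is
`√(-g)/(16πG) (∇^ν ξ^μ - ∇^μ ξ^ν - 4 e^{-2φ} F^{μν} (ξ^α A_α + λ))`. -/
def noether (G : ℝ) (ε : Gen) (F : Fields) (x : Pt) (μ ν : Fin 4) : ℝ :=
  vol F x / (16 * Real.pi * G) *
    ((∑ α, ginv F x ν α * covDeriv F ε.xi x α μ) - (∑ α, ginv F x μ α * covDeriv F ε.xi x α ν)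
      - 4 * Real.exp (-2 * F.dil x) * Fup F x μ ν * ((∑ α, ε.xi x α * F.A x α) + ε.lam x))

/-- The density `k_ε^{μν}(δΦ, Φ)` of the charge-variation two-form
`k_ε = δQ_ε - ξ · Θ(δΦ, Φ)`, where `δ` does not act on `ε`. On shell it satisfies
`ω^μ(δΦ, δ_ε Φ, Φ) = ∂_ν k_ε^{μν}` with `ω = δΘ(δ_ε Φ, Φ) - δ_ε Θ(δΦ, Φ)`. -/
def kform (G : ℝ) (ε : Gen) (F dF : Fields) (x : Pt) (μ ν : Fin 4) : ℝ :=
  vary (fun H => noether G ε H x μ ν) F dF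
    + ε.xi x μ * Theta G F dF x ν - ε.xi x ν * Theta G F dF x μ

/-- The charge variation `δH_ε = ∮ k_ε(δΦ; Φ)` over the sphere of constant `t` and `r`. -/
def chargeVar (G : ℝ) (ε : Gen) (F dF : Fields) (t r : ℝ) : ℝ :=
  ∫ θ in (0 : ℝ)..Real.pi, ∫ φ in (0 : ℝ)..(2 * Real.pi), kform G ε F dF ![t, r, θ, φ] 0 1

/-! ## The dilaton black hole -/

/-- The solution parameters: `p 0 = m`, `p 1 = q`, `p 2 = φ_∞`. The same type is used for their
variations `(δm, δq, δφ_∞)`. -/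
abbrev Params := Fin 3 → ℝ

/-- The (non-extremal) black holes: `m > 0` and `r_- < r_+`, that is `q² < 2m²`. -/
def domain : Set Params := {p | 0 < p 0 ∧ p 1 ^ 2 < 2 * p 0 ^ 2}

def Sig (p : Params) : ℝ := -(p 1) ^ 2 / (2 * p 0)

def r0 (p : Params) : ℝ := p 0 + Sig p

def rplus (p : Params) : ℝ := p 0 + r0 p

def rminus (p : Params) : ℝ := p 0 - r0 p

def fBH (p : Params) (r : ℝ) : ℝ := (r - rplus p) * (r - rminus p) / (r ^ 2 - Sig p ^ 2)

/-- The dilaton black hole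
`ds² = -f dt² + dr²/f + (r² - Σ²)(dθ² + sin²θ dφ²)`, `A = q e^{φ_∞}/(r - Σ) dt`,
`φ = ½ log((r + Σ)/(r - Σ)) + φ_∞`. -/
def blackHole (p : Params) : Fields where
  g := fun x => Matrix.diagonal
    ![-fBH p (x 1), 1 / fBH p (x 1), x 1 ^ 2 - Sig p ^ 2,
      (x 1 ^ 2 - Sig p ^ 2) * Real.sin (x 2) ^ 2]
  A := fun x => ![p 1 * Real.exp (p 2) / (x 1 - Sig p), 0, 0, 0]
  dil := fun x => 1 / 2 * Real.log ((x 1 + Sig p) / (x 1 - Sig p)) + p 2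

/-- The region outside the outer horizon, covered by the chart. -/
def exterior (p : Params) : Set Pt := {x | rplus p < x 1 ∧ 0 < x 2 ∧ x 2 < Real.pi}

/-- The parametric variation `∑ᵢ (∂Φ/∂pᵢ) δpᵢ` of a family of fields. -/
def paramVar (Φ : Params → Fields) (p dp : Params) : Fields where
  g := fun x => Matrix.of fun μ ν => ∑ i, pd i (fun p' => (Φ p').g x μ ν) p * dp i
  A := fun x μ => ∑ i, pd i (fun p' => (Φ p').A x μ) p * dp i
  dil := fun x => ∑ i, pd i (fun p' => (Φ p').dil x) p * dp i

/-! ### Horizon and asymptotic quantities -/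

/-- The vector field `∂_t + Ω ∂_φ`. -/
def tField (Ω : ℝ) : Pt → Fin 4 → ℝ := fun _ => ![1, 0, 0, Ω]

/-- `W` tends to `c` along every radial coordinate line of the chart, as `r` tends to a limit
described by the filter `l`. -/
def RadialLimit (W : Pt → ℝ) (l : Filter ℝ) (c : ℝ) : Prop :=
  ∀ t θ φ : ℝ, 0 < θ → θ < Real.pi → Tendsto (fun r => W ![t, r, θ, φ]) l (𝓝 c)

/-- The norm `g(ξ, ξ)` of a vector field. -/
def normSq (F : Fields) (xi : Pt → Fin 4 → ℝ) (x : Pt) : ℝ :=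
  ∑ μ, ∑ ν, F.g x μ ν * xi x μ * xi x ν

/-- The angular velocity `-g_{tφ}/g_{φφ}`. -/
def angVel (F : Fields) (x : Pt) : ℝ := -F.g x 0 3 / F.g x 3 3

/-- The electric potential `ξ^μ A_μ`. -/
def elPot (F : Fields) (xi : Pt → Fin 4 → ℝ) (x : Pt) : ℝ := ∑ μ, xi x μ * F.A x μ

/-- `√(-½ ∇_μ ξ_ν ∇^μ ξ^ν)`, whose value on a Killing horizon of `ξ` is the surface gravity. -/
def surfGrav (F : Fields) (xi : Pt → Fin 4 → ℝ) (x : Pt) : ℝ :=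
  Real.sqrt (-(1 / 2) * ∑ μ, ∑ ν, ∑ α, ∑ β,
    ginv F x μ α * F.g x ν β * covDeriv F xi x μ ν * covDeriv F xi x α β)

/-- The horizon potential `Φ_H = q e^{φ_∞}/(2m)`. -/
def PhiH (p : Params) : ℝ := p 1 * Real.exp (p 2) / (2 * p 0)

/-- The surface gravity `κ_H = 1/(4m)`. -/
def kappaH (p : Params) : ℝ := 1 / (4 * p 0)

/-! ### Generators and charge variations -/

/-- The generator of mass `{∂_t + Ω_∞ ∂_φ, -Φ_∞}`, with `Ω_∞ = Φ_∞ = 0`. -/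
def etaM : Gen := ⟨tField 0, fun _ => 0⟩

/-- The generator of electric charge `{0, 1}`. -/
def etaQ : Gen := ⟨fun _ => 0, fun _ => 1⟩

/-- The generator of entropy `(2π/κ_H) {∂_t + Ω_H ∂_φ, -Φ_H}`, with `Ω_H = 0`. -/
def etaS (p : Params) : Gen :=
  ⟨fun x => (2 * Real.pi / kappaH p) • tField 0 x, fun _ => 2 * Real.pi / kappaH p * -PhiH p⟩

/-- The parametric charge variation for the generators `η p`, computed at the parameters `p` on
the sphere `t = const`, `r = ρ p`. It is a one-form on parameter space. -/
def bhChargeVar (G : ℝ) (η : Params → Gen) (t : ℝ) (ρ : Params → ℝ) (p dp : Params) : ℝ :=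
  chargeVar G (η p) (blackHole p) (paramVar blackHole p dp) t (ρ p)

/-! ### Integrability -/

/-- `H` integrates the one-form `dH` over `U` when the variations are restricted to the directions
in `V`: on every translate of `V`, the derivative of `H` at the points of `U` is `dH`. -/
def Integrates (V : Submodule ℝ Params) (U : Set Params) (dH : Params → Params → ℝ)
    (H : Params → ℝ) : Prop :=
  ∀ p ∈ U, ∃ L : V →L[ℝ] ℝ, (∀ v : V, L v = dH p v) ∧
    HasFDerivAt (fun v : V => H (p + (v : Params))) L 0

/-- The one-form `dH` is integrable over `U` for the variations in `V`. -/
def IsIntegrable (V : Submodule ℝ Params) (U : Set Params) (dH : Params → Params → ℝ) : Prop :=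
  ∃ H : Params → ℝ, Integrates V U dH H

/-- The variations for which the parameter `pᵢ` is kept fixed: `δpᵢ = 0`. -/
def frozen (i : Fin 3) : Submodule ℝ Params :=
  LinearMap.ker (LinearMap.proj (R := ℝ) (φ := fun _ : Fin 3 => ℝ) i)

/-- The parameter `pᵢ` is redundant for failure of integrability: when all the parameters are
varied, some charge variation of the first law is not integrable, and all of them become
integrable when `δpᵢ` is set to zero. -/
def IsRedundant (U : Set Params) (c : Fin 3 → Params → Params → ℝ) (i : Fin 3) : Prop :=
  (∃ j, ¬ IsIntegrable ⊤ U (c j)) ∧ ∀ j, IsIntegrable (frozen i) U (c j)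

/-! ### Integrated charges -/

def massCharge (G : ℝ) (p : Params) : ℝ := p 0 / G

def elCharge (G : ℝ) (p : Params) : ℝ := p 1 * Real.exp (-p 2) / G

def entropyCharge (G : ℝ) (p : Params) : ℝ := Real.pi * (4 * p 0 ^ 2 - 2 * p 1 ^ 2) / G

end EMD

end

/-! The black hole, its parametric variation and the line `Φ + s δΦ` joining them all lie in one
ansatz (`staticFields`): five functions of `r`. Tensor calculus thus becomes one-variable calculus
with finite tables of Christoffel symbols.

Two facts make the algebra close. Since `r_- = -Σ`, a factor cancels and `f = 1 - 2m/(r - Σ)`; in `y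
= r - Σ`, `z = r + Σ` the area radius squared is `yz` and `e^{-2φ}` is proportional to `y/z`. And
`2mΣ = -q²` is the only relation between `m`, `q` and `Σ` that enters the identities. It yields the
field equations; together with its variation `m δΣ + Σ δm = -q δq` it cancels the `r`-dependence of
`k_ε`.

All three generators have the form `{k ∂_t, l}` with constants `k`, `l`, so one computation
(`kform_blackHole`) serves them: `k_ε^{tr}` is `sin θ/(4πG)` times `k (δm - q²/(2m) δφ_∞) + l
e^{-φ_∞} (δq - q δφ_∞)`. The sphere integral contributes `4π`. The first law reflects linearity in
`(k, l)`, since the entropy generator is `2π/κ_H` times the mass generator minus `Φ_H` times the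
charge generator.

The charge and entropy one-forms are differentials of explicit functions. The curl of the mass
one-form is proportional to `d(q²/m) ∧ dφ_∞`. If `V` has dimension at least two and some `v ∈ V`
moves `φ_∞`, choose `w ≠ 0` in `V` with `δφ_∞ = 0`. Integrability would force `q²/m` to be
stationary along `w` throughout an open set, hence `w = 0` (`not_isIntegrable_mass`). A potential
need only be differentiable along translates of `V`, so symmetry of second derivatives is
unavailable; `Integrates.eventually_eq` replaces it, using that the form has the constant value `w 0
/ G` on `w`. -/

noncomputable section

namespace EMD

/-! ## Static spherically symmetric fields -/

/-- The static spherically symmetric fields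
`ds² = -a dt² + b dr² + c (dθ² + sin²θ dφ²)`, `A = u dt`, `φ = w`. -/
def staticFields (a b c u w : ℝ → ℝ) : Fields where
  g := fun x => Matrix.diagonal
    ![-a (x 1), b (x 1), c (x 1), c (x 1) * Real.sin (x 2) ^ 2]
  A := fun x => ![u (x 1), 0, 0, 0]
  dil := fun x => w (x 1)

/-- The closed forms of the fields hold only near a point of the exterior; this allows them to be
differentiated there. -/
theorem pd_congr {n : ℕ} {i : Fin n} {f h : (Fin n → ℝ) → ℝ} {x : Fin n → ℝ}
    (e : f =ᶠ[𝓝 x] h) : pd i f x = pd i h x := by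
  refine Filter.EventuallyEq.deriv_eq ?_
  have hc : Tendsto (fun s : ℝ => Function.update x i s) (𝓝 (x i)) (𝓝 x) := by
    have : ContinuousAt (fun s : ℝ => Function.update x i s) (x i) :=
      (continuous_const.update i continuous_id).continuousAt
    simpa [ContinuousAt] using this
  exact hc.eventually e

theorem pd_const {n : ℕ} (i : Fin n) (k : ℝ) (x : Fin n → ℝ) :
    pd i (fun _ => k) x = 0 := by
  simp [pd]

theorem pd_mul_separated (h k : ℝ → ℝ) (i : Fin 4) (x : Pt) :
    pd i (fun y : Pt => h (y 1) * k (y 2)) x =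
      if i = 1 then deriv h (x 1) * k (x 2)
      else if i = 2 then h (x 1) * deriv k (x 2) else 0 := by
  fin_cases i <;> simp [pd, Function.update]

theorem pd_radial (h : ℝ → ℝ) (i : Fin 4) (x : Pt) :
    pd i (fun y : Pt => h (y 1)) x = if i = 1 then deriv h (x 1) else 0 := by
  have := pd_mul_separated h (fun _ => 1) i x
  simp only [mul_one, deriv_const, mul_zero, ite_self] at this
  exact this

theorem deriv_sin_sq (θ : ℝ) :
    deriv (fun s => Real.sin s ^ 2) θ = 2 * Real.sin θ * Real.cos θ := by
  simp

/-- The derivatives `∂_α g_{νν}` of a static metric, from the values and radial derivatives of its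
coefficients. -/
def metricDeriv (a' b' c c' s k : ℝ) (α ν : Fin 4) : ℝ :=
  if α = 1 then ![-a', b', c', c' * s ^ 2] ν
  else if α = 2 then ![0, 0, 0, c * (2 * s * k)] ν else 0

theorem pd_static_metric (a b c u w : ℝ → ℝ) (x : Pt) (α ν β : Fin 4) :
    pd α (fun y => (staticFields a b c u w).g y ν β) x =
      if ν = β then metricDeriv (deriv a (x 1)) (deriv b (x 1)) (c (x 1)) (deriv c (x 1))
        (Real.sin (x 2)) (Real.cos (x 2)) α ν else 0 := by
  by_cases h : ν = β
  · subst h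
    simp only [staticFields, Matrix.diagonal_apply_eq, metricDeriv, if_true]
    fin_cases ν
    · have := pd_radial (fun r => -a r) α x
      simp only [deriv.fun_neg] at this
      simpa using this
    · simpa using pd_radial b α x
    · simpa using pd_radial c α x
    · have := pd_mul_separated c (fun s => Real.sin s ^ 2) α x
      rw [deriv_sin_sq] at this
      simpa using this
  · simp only [staticFields, h, if_false, Matrix.diagonal_apply_ne _ h, pd_const]

theorem ginv_static {a b c u w : ℝ → ℝ} {x : Pt} (ha : a (x 1) ≠ 0) (hb : b (x 1) ≠ 0)
    (hc : c (x 1) ≠ 0) (hs : Real.sin (x 2) ≠ 0) :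
    ginv (staticFields a b c u w) x = Matrix.diagonal
      ![-(a (x 1))⁻¹, (b (x 1))⁻¹, (c (x 1))⁻¹, (c (x 1) * Real.sin (x 2) ^ 2)⁻¹] := by
  refine Matrix.inv_eq_right_inv ?_
  simp only [staticFields, Matrix.diagonal_mul_diagonal]
  rw [← Matrix.diagonal_one]
  congr 1
  funext i
  fin_cases i
  · simp [ha]
  · simp [hb]
  · simp [hc]
  · simpa using mul_inv_cancel₀ (mul_ne_zero hc (pow_ne_zero 2 hs))

theorem vol_static (a b c u w : ℝ → ℝ) (x : Pt) :
    vol (staticFields a b c u w) x =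
      Real.sqrt (a (x 1) * b (x 1) * (c (x 1) * Real.sin (x 2)) ^ 2) := by
  simp only [vol, staticFields, Matrix.det_diagonal, Fin.prod_univ_four]
  congr 1
  simp
  ring

/-- The Christoffel symbols of a static metric, from the values and radial derivatives of its
coefficients. -/
def christoffel (a b c a' b' c' s k : ℝ) : Fin 4 → Fin 4 → Fin 4 → ℝ :=
  ![![![0, a' / (2 * a), 0, 0], ![a' / (2 * a), 0, 0, 0], 0, 0],
    ![![a' / (2 * b), 0, 0, 0], ![0, b' / (2 * b), 0, 0], ![0, 0, -c' / (2 * b), 0],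
      ![0, 0, 0, -c' / (2 * b) * s ^ 2]],
    ![0, ![0, 0, c' / (2 * c), 0], ![0, c' / (2 * c), 0, 0], ![0, 0, 0, -(s * k)]],
    ![0, ![0, 0, 0, c' / (2 * c)], ![0, 0, 0, k / s], ![0, c' / (2 * c), k / s, 0]]]

/-- Here `a` and `b` are independent: along `Φ + s δΦ` the relation `g_{tt} g_{rr} = -1` survives
only to first order in `s`, so `δΓ` needs the general table. -/
theorem Gam_static {a b c u w : ℝ → ℝ} {x : Pt} (ha : a (x 1) ≠ 0) (hb : b (x 1) ≠ 0)
    (hc : c (x 1) ≠ 0) (hs : Real.sin (x 2) ≠ 0) (μ α β : Fin 4) :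
    Gam (staticFields a b c u w) x μ α β =
      christoffel (a (x 1)) (b (x 1)) (c (x 1)) (deriv a (x 1)) (deriv b (x 1)) (deriv c (x 1))
        (Real.sin (x 2)) (Real.cos (x 2)) μ α β := by
  simp only [Gam, ginv_static ha hb hc hs, pd_static_metric]
  rw [Finset.sum_eq_single μ (fun ν _ h => by rw [Matrix.diagonal_apply_ne' _ h, zero_mul])
    (by simp), Matrix.diagonal_apply_eq]
  generalize a (x 1) = a at *
  generalize b (x 1) = b at *
  generalize c (x 1) = c at *
  generalize Real.sin (x 2) = s at *
  fin_cases μ <;> fin_cases α <;> fin_cases β <;>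
    simp [metricDeriv, christoffel] <;> field_simp

theorem Fdown_static (a b c u w : ℝ → ℝ) (x : Pt) (μ ν : Fin 4) :
    Fdown (staticFields a b c u w) x μ ν =
      if μ = 1 ∧ ν = 0 then deriv u (x 1) else if μ = 0 ∧ ν = 1 then -deriv u (x 1) else 0 := by
  have h : ∀ i j : Fin 4, pd i (fun y => (staticFields a b c u w).A y j) x =
      if i = 1 ∧ j = 0 then deriv u (x 1) else 0 := by
    intro i j
    fin_cases j
    · simpa [staticFields] using pd_radial u i x
    all_goals simp [staticFields, pd_const]
  simp only [Fdown, h]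
  fin_cases μ <;> fin_cases ν <;> simp

theorem Fup_static {a b c u w : ℝ → ℝ} {x : Pt} (ha : a (x 1) ≠ 0) (hb : b (x 1) ≠ 0)
    (hc : c (x 1) ≠ 0) (hs : Real.sin (x 2) ≠ 0) (μ ν : Fin 4) :
    Fup (staticFields a b c u w) x μ ν =
      if μ = 1 ∧ ν = 0 then -deriv u (x 1) / (a (x 1) * b (x 1))
      else if μ = 0 ∧ ν = 1 then deriv u (x 1) / (a (x 1) * b (x 1)) else 0 := by
  simp only [Fup, ginv_static ha hb hc hs]
  rw [Finset.sum_eq_single μ (fun α _ h => by simp [Matrix.diagonal_apply_ne' _ h]) (by simp),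
    Finset.sum_eq_single ν (fun α _ h => by simp [Matrix.diagonal_apply_ne' _ h]) (by simp),
    Matrix.diagonal_apply_eq, Matrix.diagonal_apply_eq, Fdown_static]
  fin_cases μ <;> fin_cases ν <;> simp <;> field_simp

theorem Fsq_static {a b c u w : ℝ → ℝ} {x : Pt} (ha : a (x 1) ≠ 0) (hb : b (x 1) ≠ 0)
    (hc : c (x 1) ≠ 0) (hs : Real.sin (x 2) ≠ 0) :
    Fsq (staticFields a b c u w) x = -2 * deriv u (x 1) ^ 2 / (a (x 1) * b (x 1)) := by
  simp only [Fsq, Fdown_static, Fup_static ha hb hc hs, Fin.sum_univ_four]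
  simp
  ring

theorem pd_dil_static (a b c u w : ℝ → ℝ) (x : Pt) (μ : Fin 4) :
    pd μ (staticFields a b c u w).dil x = if μ = 1 then deriv w (x 1) else 0 :=
  pd_radial w μ x

theorem gradDil_static {a b c u w : ℝ → ℝ} {x : Pt} (ha : a (x 1) ≠ 0) (hb : b (x 1) ≠ 0)
    (hc : c (x 1) ≠ 0) (hs : Real.sin (x 2) ≠ 0) (μ : Fin 4) :
    gradDil (staticFields a b c u w) x μ = if μ = 1 then deriv w (x 1) / b (x 1) else 0 := by
  simp only [gradDil, ginv_static ha hb hc hs, pd_dil_static]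
  fin_cases μ <;> simp [Matrix.diagonal]
  ring

/-- The ansatz is linear in its five functions, so every first variation becomes an `s`-derivative
of an explicit expression. -/
theorem along_static (a b c u w da db dc du dw : ℝ → ℝ) (s : ℝ) :
    (staticFields a b c u w).along (staticFields da db dc du dw) s =
      staticFields (fun r => a r + s * da r) (fun r => b r + s * db r) (fun r => c r + s * dc r)
        (fun r => u r + s * du r) (fun r => w r + s * dw r) := by
  simp only [Fields.along, staticFields, Fields.mk.injEq, and_true]
  constructor
  · funext x i j
    by_cases h : i = j
    · subst h
      fin_cases i <;> simp <;> ring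
    · simp [h]
  · funext x i
    fin_cases i <;> simp

end EMD

namespace EMD

/-! ## Curvature of static fields with `g_{tt} g_{rr} = -1` -/

theorem pd_radial_polar (h : ℝ → ℝ → ℝ) (i : Fin 4) (x : Pt) :
    pd i (fun y : Pt => h (y 1) (y 2)) x =
      if i = 1 then deriv (fun r => h r (x 2)) (x 1)
      else if i = 2 then deriv (h (x 1)) (x 2) else 0 := by
  fin_cases i <;> simp [pd, Function.update]

/-- The radial derivatives of the Christoffel symbols of a static metric with
`g_{tt} g_{rr} = -1`. -/
def christoffelRadial (a c a' c' a₂ c₂ s : ℝ) : Fin 4 → Fin 4 → Fin 4 → ℝ :=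
  ![![![0, (a₂ * a - a' ^ 2) / (2 * a ^ 2), 0, 0],
      ![(a₂ * a - a' ^ 2) / (2 * a ^ 2), 0, 0, 0], 0, 0],
    ![![(a' ^ 2 + a * a₂) / 2, 0, 0, 0], ![0, -(a₂ * a - a' ^ 2) / (2 * a ^ 2), 0, 0],
      ![0, 0, -(c₂ * a + c' * a') / 2, 0], ![0, 0, 0, -(c₂ * a + c' * a') / 2 * s ^ 2]],
    ![0, ![0, 0, (c₂ * c - c' ^ 2) / (2 * c ^ 2), 0],
      ![0, (c₂ * c - c' ^ 2) / (2 * c ^ 2), 0, 0], ![0, 0, 0, 0]],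
    ![0, ![0, 0, 0, (c₂ * c - c' ^ 2) / (2 * c ^ 2)], ![0, 0, 0, 0],
      ![0, (c₂ * c - c' ^ 2) / (2 * c ^ 2), 0, 0]]]

/-- The polar derivatives of the Christoffel symbols of a static metric with
`g_{tt} g_{rr} = -1`. -/
def christoffelPolar (a c' s k : ℝ) : Fin 4 → Fin 4 → Fin 4 → ℝ :=
  ![0, ![0, 0, 0, ![0, 0, 0, -(c' * a) * (s * k)]], ![0, 0, 0, ![0, 0, 0, s ^ 2 - k ^ 2]],
    ![0, 0, ![0, 0, 0, -(1 / s ^ 2)], ![0, 0, -(1 / s ^ 2), 0]]]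

/-- `christoffel` for `b = 1 / a`. -/
def christoffelInv (a c a' c' s k : ℝ) : Fin 4 → Fin 4 → Fin 4 → ℝ :=
  ![![![0, a' / (2 * a), 0, 0], ![a' / (2 * a), 0, 0, 0], 0, 0],
    ![![a * a' / 2, 0, 0, 0], ![0, -a' / (2 * a), 0, 0], ![0, 0, -(c' * a) / 2, 0],
      ![0, 0, 0, -(c' * a) / 2 * s ^ 2]],
    ![0, ![0, 0, c' / (2 * c), 0], ![0, c' / (2 * c), 0, 0], ![0, 0, 0, -(s * k)]],
    ![0, ![0, 0, 0, c' / (2 * c)], ![0, 0, 0, k / s], ![0, c' / (2 * c), k / s, 0]]]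

theorem christoffel_inv {a : ℝ} (ha : a ≠ 0) (c a' c' s k : ℝ) (μ α β : Fin 4) :
    christoffel a (1 / a) c a' (-a' / a ^ 2) c' s k μ α β =
      christoffelInv a c a' c' s k μ α β := by
  fin_cases μ <;> fin_cases α <;> fin_cases β <;>
    simp [christoffel, christoffelInv] <;> field_simp
  simp

theorem hasDerivAt_christoffelInv_radial {a a₁ c c₁ : ℝ → ℝ} {r a₂ c₂ : ℝ}
    (ha : HasDerivAt a (a₁ r) r) (ha₁ : HasDerivAt a₁ a₂ r)
    (hc : HasDerivAt c (c₁ r) r) (hc₁ : HasDerivAt c₁ c₂ r) (ha0 : a r ≠ 0) (hc0 : c r ≠ 0)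
    (s k : ℝ) (μ α β : Fin 4) :
    HasDerivAt (fun r => christoffelInv (a r) (c r) (a₁ r) (c₁ r) s k μ α β)
      (christoffelRadial (a r) (c r) (a₁ r) (c₁ r) a₂ c₂ s μ α β) r := by
  have quot : ∀ {f f₁ : ℝ → ℝ} {f₂ : ℝ}, HasDerivAt f (f₁ r) r → HasDerivAt f₁ f₂ r → f r ≠ 0 →
      HasDerivAt (fun r => f₁ r / (2 * f r)) ((f₂ * f r - f₁ r ^ 2) / (2 * f r ^ 2)) r := by
    intro f f₁ f₂ hf hf₁ h0
    refine (hf₁.fun_div (hf.const_mul 2) (mul_ne_zero two_ne_zero h0)).congr_deriv ?_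
    field_simp
  have hqa := quot ha ha₁ ha0
  have hqc := quot hc hc₁ hc0
  have hna : HasDerivAt (fun r => -a₁ r / (2 * a r))
      (-(a₂ * a r - a₁ r ^ 2) / (2 * a r ^ 2)) r := by
    refine (hqa.fun_neg.congr_deriv (by ring)).congr_of_eventuallyEq (.of_forall fun r => ?_)
    ring
  have haa : HasDerivAt (fun r => a r * a₁ r / 2) ((a₁ r ^ 2 + a r * a₂) / 2) r :=
    ((ha.fun_mul ha₁).div_const 2).congr_deriv (by ring)
  have hca : HasDerivAt (fun r => -(c₁ r * a r) / 2) (-(c₂ * a r + c₁ r * a₁ r) / 2) r :=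
    ((hc₁.fun_mul ha).fun_neg.div_const 2).congr_deriv (by ring)
  have hcs := hca.mul_const (s ^ 2)
  -- Each of the 64 entries is definitionally one of the functions above or constant in `r`.
  fin_cases μ <;> fin_cases α <;> fin_cases β <;>
    first
    | exact hasDerivAt_const _ _
    | exact hqa
    | exact hqc
    | exact hna
    | exact haa
    | exact hca
    | exact hcs

theorem hasDerivAt_christoffelInv_polar {θ : ℝ} (hs : Real.sin θ ≠ 0) (a c a' c' : ℝ)
    (μ α β : Fin 4) :
    HasDerivAt (fun θ => christoffelInv a c a' c' (Real.sin θ) (Real.cos θ) μ α β)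
      (christoffelPolar a c' (Real.sin θ) (Real.cos θ) μ α β) θ := by
  have hS := Real.hasDerivAt_sin θ
  have hC := Real.hasDerivAt_cos θ
  have h1 : HasDerivAt (fun θ => -(c' * a) / 2 * Real.sin θ ^ 2)
      (-(c' * a) * (Real.sin θ * Real.cos θ)) θ :=
    ((hS.fun_pow 2).const_mul _).congr_deriv (by simp; ring)
  have h2 : HasDerivAt (fun θ => -(Real.sin θ * Real.cos θ))
      (Real.sin θ ^ 2 - Real.cos θ ^ 2) θ :=
    (hS.fun_mul hC).fun_neg.congr_deriv (by ring)
  have h3 : HasDerivAt (fun θ => Real.cos θ / Real.sin θ) (-(1 / Real.sin θ ^ 2)) θ := by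
    refine (hC.fun_div hS hs).congr_deriv ?_
    rw [← Real.sin_sq_add_cos_sq θ]
    ring
  fin_cases μ <;> fin_cases α <;> fin_cases β <;>
    first
    | exact hasDerivAt_const _ _
    | exact h1
    | exact h2
    | exact h3

/-- The Ricci tensor of a static metric with `g_{tt} g_{rr} = -1`. -/
def staticRicci (a c a' c' a₂ c₂ s : ℝ) : Fin 4 → ℝ :=
  ![a * (a₂ / 2 + a' * c' / (2 * c)),
    -(a₂ / 2 + a' * c' / (2 * c)) / a - c₂ / c + c' ^ 2 / (2 * c ^ 2),
    1 - (a * c₂ + a' * c') / 2,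
    (1 - (a * c₂ + a' * c') / 2) * s ^ 2]

variable {a a₁ c c₁ : ℝ → ℝ} {a₂ c₂ : ℝ} {x : Pt}

theorem Gam_static_inv (u w : ℝ → ℝ) (ha : HasDerivAt a (a₁ (x 1)) (x 1))
    (hc : HasDerivAt c (c₁ (x 1)) (x 1)) (ha0 : a (x 1) ≠ 0) (hc0 : c (x 1) ≠ 0)
    (hs : Real.sin (x 2) ≠ 0) (μ α β : Fin 4) :
    Gam (staticFields a (fun r => 1 / a r) c u w) x μ α β =
      christoffelInv (a (x 1)) (c (x 1)) (a₁ (x 1)) (c₁ (x 1)) (Real.sin (x 2)) (Real.cos (x 2))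
        μ α β := by
  have hb : HasDerivAt (fun r => 1 / a r) (-a₁ (x 1) / a (x 1) ^ 2) (x 1) := by
    simpa only [one_div] using ha.fun_inv ha0
  rw [Gam_static (b := fun r => 1 / a r) ha0 (one_div_ne_zero ha0) hc0 hs, ha.deriv, hb.deriv, hc.deriv,
    christoffel_inv ha0]

theorem eventually_coord {P : ℝ → Prop} {i : Fin 4} (h : ∀ᶠ r in 𝓝 (x i), P r) :
    ∀ᶠ y in 𝓝 x, P (y i) :=
  (continuous_apply i).continuousAt.eventually h

/-- The symbols are differentiated once more, so the first derivatives of `a` and `c` are needed on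
a neighbourhood, the second ones only at the point. -/
theorem pd_Gam_static_inv (u w : ℝ → ℝ) (ha : ∀ᶠ r in 𝓝 (x 1), HasDerivAt a (a₁ r) r)
    (ha₁ : HasDerivAt a₁ a₂ (x 1)) (hc : ∀ᶠ r in 𝓝 (x 1), HasDerivAt c (c₁ r) r)
    (hc₁ : HasDerivAt c₁ c₂ (x 1)) (ha0 : a (x 1) ≠ 0) (hc0 : c (x 1) ≠ 0)
    (hs : Real.sin (x 2) ≠ 0) (ρ μ α β : Fin 4) :
    pd ρ (fun y => Gam (staticFields a (fun r => 1 / a r) c u w) y μ α β) x =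
      if ρ = 1 then christoffelRadial (a (x 1)) (c (x 1)) (a₁ (x 1)) (c₁ (x 1)) a₂ c₂
        (Real.sin (x 2)) μ α β
      else if ρ = 2 then christoffelPolar (a (x 1)) (c₁ (x 1)) (Real.sin (x 2)) (Real.cos (x 2))
        μ α β
      else 0 := by
  have hA := ha.self_of_nhds
  have hC := hc.self_of_nhds
  have e : (fun y => Gam (staticFields a (fun r => 1 / a r) c u w) y μ α β) =ᶠ[𝓝 x] fun y =>
      christoffelInv (a (y 1)) (c (y 1)) (a₁ (y 1)) (c₁ (y 1)) (Real.sin (y 2)) (Real.cos (y 2))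
        μ α β := by
    filter_upwards [eventually_coord ha, eventually_coord hc,
      eventually_coord (hA.continuousAt.eventually_ne ha0),
      eventually_coord (hC.continuousAt.eventually_ne hc0),
      eventually_coord (Real.continuous_sin.continuousAt.eventually_ne hs)] with y h1 h2 h3 h4 h5
    exact Gam_static_inv u w h1 h2 h3 h4 h5 μ α β
  rw [pd_congr e, pd_radial_polar (fun r θ => christoffelInv (a r) (c r) (a₁ r) (c₁ r)
    (Real.sin θ) (Real.cos θ) μ α β),
    (hasDerivAt_christoffelInv_radial hA ha₁ hC hc₁ ha0 hc0 _ _ μ α β).deriv,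
    (hasDerivAt_christoffelInv_polar hs _ _ _ _ μ α β).deriv]

theorem Ric_static (u w : ℝ → ℝ) (ha : ∀ᶠ r in 𝓝 (x 1), HasDerivAt a (a₁ r) r)
    (ha₁ : HasDerivAt a₁ a₂ (x 1)) (hc : ∀ᶠ r in 𝓝 (x 1), HasDerivAt c (c₁ r) r)
    (hc₁ : HasDerivAt c₁ c₂ (x 1)) (ha0 : a (x 1) ≠ 0) (hc0 : c (x 1) ≠ 0)
    (hs : Real.sin (x 2) ≠ 0) (α β : Fin 4) :
    Ric (staticFields a (fun r => 1 / a r) c u w) x α β =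
      if α = β then staticRicci (a (x 1)) (c (x 1)) (a₁ (x 1)) (c₁ (x 1)) a₂ c₂
        (Real.sin (x 2)) α else 0 := by
  simp only [Ric, pd_Gam_static_inv u w ha ha₁ hc hc₁ ha0 hc0 hs,
    Gam_static_inv u w ha.self_of_nhds hc.self_of_nhds ha0 hc0 hs, Fin.sum_univ_four]
  have hk : Real.cos (x 2) ^ 2 = 1 - Real.sin (x 2) ^ 2 := by
    rw [← Real.sin_sq_add_cos_sq (x 2)]; ring
  generalize a (x 1) = a at *
  generalize c (x 1) = c at *
  generalize a₁ (x 1) = a₁ at *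
  generalize c₁ (x 1) = c₁ at *
  generalize Real.cos (x 2) = k at *
  generalize Real.sin (x 2) = s at *
  fin_cases α <;> fin_cases β <;>
    simp [christoffelInv, christoffelRadial, christoffelPolar, staticRicci] <;> field_simp <;>
    (try rw [hk]) <;> ring

end EMD

namespace EMD

/-! ## The black hole as a static field configuration -/

def potential (p : Params) (r : ℝ) : ℝ := p 1 * Real.exp (p 2) / (r - Sig p)

def dilaton (p : Params) (r : ℝ) : ℝ := 1 / 2 * Real.log ((r + Sig p) / (r - Sig p)) + p 2

def areaRadiusSq (p : Params) (r : ℝ) : ℝ := r ^ 2 - Sig p ^ 2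

theorem blackHole_eq_static (p : Params) :
    blackHole p = staticFields (fBH p) (fun r => 1 / fBH p r) (areaRadiusSq p) (potential p)
      (dilaton p) := rfl

variable {p : Params} {r : ℝ}

theorem two_mul_mass_mul_Sig (hp : p ∈ domain) : 2 * p 0 * Sig p = -(p 1) ^ 2 := by
  have := hp.1.ne'
  unfold Sig
  field_simp

/-- This is `r_0 > 0`, the form in which `q² < 2m²` is used: it keeps `r + Σ` positive down to the
horizon. -/
theorem mass_add_Sig_pos (hp : p ∈ domain) : 0 < p 0 + Sig p := by
  have h1 := two_mul_mass_mul_Sig hp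
  have h2 := hp.1
  have h3 := hp.2
  by_contra! h
  nlinarith

theorem rplus_eq (p : Params) : rplus p = 2 * p 0 + Sig p := by
  unfold rplus r0
  ring

theorem rminus_eq (p : Params) : rminus p = -Sig p := by
  unfold rminus r0
  ring

theorem two_mul_mass_lt (hr : rplus p < r) : 2 * p 0 < r - Sig p := by
  rw [rplus_eq] at hr
  linarith

theorem sub_Sig_pos (hp : p ∈ domain) (hr : rplus p ≤ r) : 0 < r - Sig p := by
  rw [rplus_eq] at hr
  linarith [hp.1]

theorem add_Sig_pos (hp : p ∈ domain) (hr : rplus p ≤ r) : 0 < r + Sig p := by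
  rw [rplus_eq] at hr
  linarith [mass_add_Sig_pos hp]

/-- The inner root is `-Σ`, so `r + Σ` cancels and `f` is the Schwarzschild function in `r - Σ`. -/
theorem fBH_eq (hz : r + Sig p ≠ 0) : fBH p r = (r - Sig p - 2 * p 0) / (r - Sig p) := by
  unfold fBH
  rw [rplus_eq, rminus_eq, ← mul_div_mul_right _ (r - Sig p) hz]
  ring_nf

theorem fBH_pos (hp : p ∈ domain) (hr : rplus p < r) : 0 < fBH p r := by
  rw [fBH_eq (add_Sig_pos hp hr.le).ne']
  exact div_pos (by linarith [two_mul_mass_lt hr]) (sub_Sig_pos hp hr.le)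

theorem areaRadiusSq_eq (p : Params) (r : ℝ) :
    areaRadiusSq p r = (r + Sig p) * (r - Sig p) := by
  unfold areaRadiusSq
  ring

theorem areaRadiusSq_pos (hp : p ∈ domain) (hr : rplus p < r) : 0 < areaRadiusSq p r := by
  rw [areaRadiusSq_eq]
  exact mul_pos (add_Sig_pos hp hr.le) (sub_Sig_pos hp hr.le)

/-- The horizon itself is included, so that continuity there gives the limit of the norm of `∂_t`.
-/
theorem hasDerivAt_fBH (hp : p ∈ domain) (hr : rplus p ≤ r) :
    HasDerivAt (fBH p) (2 * p 0 / (r - Sig p) ^ 2) r := by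
  have hy := (sub_Sig_pos hp hr).ne'
  have hz := (add_Sig_pos hp hr).ne'
  have e : fBH p =ᶠ[𝓝 r] fun r => (r - Sig p - 2 * p 0) / (r - Sig p) := by
    have hc : ContinuousAt (fun r => r + Sig p) r := by fun_prop
    filter_upwards [hc.eventually_ne hz] with s hs
    exact fBH_eq hs
  have hd := (hasDerivAt_id r).sub_const (Sig p)
  refine (((hd.sub_const (2 * p 0)).fun_div hd hy).congr_of_eventuallyEq e).congr_deriv ?_
  simp

theorem hasDerivAt_fBH_deriv (hy : r - Sig p ≠ 0) :
    HasDerivAt (fun r => 2 * p 0 / (r - Sig p) ^ 2) (-4 * p 0 / (r - Sig p) ^ 3) r := by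
  have hd := ((hasDerivAt_id r).sub_const (Sig p)).fun_pow 2
  refine ((hasDerivAt_const r (2 * p 0)).fun_div hd (pow_ne_zero 2 hy)).congr_deriv ?_
  simp
  field_simp
  ring

theorem hasDerivAt_areaRadiusSq (p : Params) (r : ℝ) :
    HasDerivAt (areaRadiusSq p) (2 * r) r := by
  refine (((hasDerivAt_id r).fun_pow 2).sub_const (Sig p ^ 2)).congr_deriv ?_
  simp

theorem hasDerivAt_potential (hy : r - Sig p ≠ 0) :
    HasDerivAt (potential p) (-(p 1 * Real.exp (p 2)) / (r - Sig p) ^ 2) r := by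
  have hd := (hasDerivAt_id r).sub_const (Sig p)
  refine ((hasDerivAt_const r (p 1 * Real.exp (p 2))).fun_div hd hy).congr_deriv ?_
  simp

theorem hasDerivAt_dilaton (hy : r - Sig p ≠ 0) (hz : r + Sig p ≠ 0) :
    HasDerivAt (dilaton p) (-Sig p / ((r + Sig p) * (r - Sig p))) r := by
  have h1 := (hasDerivAt_id r).add_const (Sig p)
  have h2 := (hasDerivAt_id r).sub_const (Sig p)
  refine ((((h1.fun_div h2 hy).log (div_ne_zero hz hy)).const_mul (1 / 2)).add_const
    (p 2)).congr_deriv ?_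
  simp
  field_simp
  ring

theorem exp_dilaton (hy : 0 < r - Sig p) (hz : 0 < r + Sig p) :
    Real.exp (-2 * dilaton p r) = (r - Sig p) / ((r + Sig p) * Real.exp (p 2) ^ 2) := by
  have : -2 * dilaton p r = -(Real.log ((r + Sig p) / (r - Sig p)) + (p 2 + p 2)) := by
    unfold dilaton
    ring
  rw [this, Real.exp_neg, Real.exp_add, Real.exp_log (div_pos hz hy), Real.exp_add]
  have := (Real.exp_pos (p 2)).ne'
  field_simp

theorem isOpen_exterior (p : Params) : IsOpen (exterior p) :=
  (isOpen_lt continuous_const (continuous_apply 1)).inter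
    ((isOpen_lt continuous_const (continuous_apply 2)).inter
      (isOpen_lt (continuous_apply 2) continuous_const))

variable {x : Pt}

theorem sin_pos_of_mem_exterior (hx : x ∈ exterior p) : 0 < Real.sin (x 2) :=
  Real.sin_pos_of_pos_of_lt_pi hx.2.1 hx.2.2

theorem vol_blackHole (hp : p ∈ domain) (hx : x ∈ exterior p) :
    vol (blackHole p) x = areaRadiusSq p (x 1) * Real.sin (x 2) := by
  rw [blackHole_eq_static, vol_static, mul_one_div_cancel (fBH_pos hp hx.1).ne', one_mul,
    Real.sqrt_sq (mul_pos (areaRadiusSq_pos hp hx.1) (sin_pos_of_mem_exterior hx)).le]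

theorem Fup_blackHole (hp : p ∈ domain) (hx : x ∈ exterior p) (μ ν : Fin 4) :
    Fup (blackHole p) x μ ν =
      if μ = 1 ∧ ν = 0 then p 1 * Real.exp (p 2) / (x 1 - Sig p) ^ 2
      else if μ = 0 ∧ ν = 1 then -(p 1 * Real.exp (p 2)) / (x 1 - Sig p) ^ 2 else 0 := by
  have ha := (fBH_pos hp hx.1).ne'
  rw [blackHole_eq_static, Fup_static (b := fun r => 1 / fBH p r) ha (one_div_ne_zero ha)
    (areaRadiusSq_pos hp hx.1).ne' (sin_pos_of_mem_exterior hx).ne',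
    (hasDerivAt_potential (sub_Sig_pos hp hx.1.le).ne').deriv, mul_one_div_cancel ha, div_one,
    div_one, neg_div, neg_neg]

theorem gradDil_blackHole (hp : p ∈ domain) (hx : x ∈ exterior p) (μ : Fin 4) :
    gradDil (blackHole p) x μ = if μ = 1 then
      -Sig p / ((x 1 + Sig p) * (x 1 - Sig p)) * fBH p (x 1) else 0 := by
  have ha := (fBH_pos hp hx.1).ne'
  rw [blackHole_eq_static, gradDil_static (b := fun r => 1 / fBH p r) ha (one_div_ne_zero ha)
    (areaRadiusSq_pos hp hx.1).ne' (sin_pos_of_mem_exterior hx).ne',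
    (hasDerivAt_dilaton (sub_Sig_pos hp hx.1.le).ne' (add_Sig_pos hp hx.1.le).ne').deriv,
    div_div_eq_mul_div, div_one]

theorem Fsq_blackHole (hp : p ∈ domain) (hx : x ∈ exterior p) :
    Fsq (blackHole p) x = -2 * (p 1 * Real.exp (p 2)) ^ 2 / (x 1 - Sig p) ^ 4 := by
  have ha := (fBH_pos hp hx.1).ne'
  have hy := (sub_Sig_pos hp hx.1.le).ne'
  rw [blackHole_eq_static, Fsq_static (b := fun r => 1 / fBH p r) ha (one_div_ne_zero ha)
    (areaRadiusSq_pos hp hx.1).ne' (sin_pos_of_mem_exterior hx).ne',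
    (hasDerivAt_potential hy).deriv, mul_one_div_cancel ha, div_one]
  field_simp

theorem Ric_blackHole (hp : p ∈ domain) (hx : x ∈ exterior p) (α β : Fin 4) :
    Ric (blackHole p) x α β = if α = β then staticRicci (fBH p (x 1)) (areaRadiusSq p (x 1))
      (2 * p 0 / (x 1 - Sig p) ^ 2) (2 * x 1) (-4 * p 0 / (x 1 - Sig p) ^ 3) 2
      (Real.sin (x 2)) α else 0 := by
  rw [blackHole_eq_static]
  refine Ric_static (a₁ := fun r => 2 * p 0 / (r - Sig p) ^ 2) (c₁ := fun r => 2 * r) _ _ ?_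
    (hasDerivAt_fBH_deriv (sub_Sig_pos hp hx.1.le).ne')
    (.of_forall fun r => hasDerivAt_areaRadiusSq p r) ?_ (fBH_pos hp hx.1).ne'
    (areaRadiusSq_pos hp hx.1).ne' (sin_pos_of_mem_exterior hx).ne' α β
  · filter_upwards [lt_mem_nhds hx.1] with s hs
    exact hasDerivAt_fBH hp hs.le
  · simpa using (hasDerivAt_id (x 1)).const_mul 2

/-! ## The field equations -/

/-- Gauss's law: `√(-g) e^{-2φ} F^{rt} = q e^{-φ_∞} sin θ` does not depend on `r` or `t`, so each
term of the divergence vanishes. -/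
theorem gauge_equation_blackHole (hp : p ∈ domain) (hx : x ∈ exterior p) (ν : Fin 4) :
    ∑ μ, pd μ (fun y => vol (blackHole p) y * Real.exp (-2 * (blackHole p).dil y) *
      Fup (blackHole p) y μ ν) x = 0 := by
  refine Finset.sum_eq_zero fun μ _ => ?_
  have e : (fun y => vol (blackHole p) y * Real.exp (-2 * (blackHole p).dil y) *
      Fup (blackHole p) y μ ν) =ᶠ[𝓝 x] fun y => (fun _ θ => Real.sin θ *
        (if μ = 1 ∧ ν = 0 then p 1 / Real.exp (p 2)
          else if μ = 0 ∧ ν = 1 then -(p 1 / Real.exp (p 2)) else 0)) (y 1) (y 2) := by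
    filter_upwards [(isOpen_exterior p).mem_nhds hx] with y hy
    have h1 := sub_Sig_pos hp hy.1.le
    have h2 := add_Sig_pos hp hy.1.le
    have h3 := Real.exp_pos (p 2)
    have h4 : Real.exp (-2 * (blackHole p).dil y) = _ := exp_dilaton h1 h2
    rw [vol_blackHole hp hy, h4, Fup_blackHole hp hy, areaRadiusSq_eq]
    split_ifs
    · field_simp
    · field_simp
    · simp
  rw [pd_congr e, pd_radial_polar (fun _ θ => Real.sin θ * _)]
  fin_cases μ <;> simp

/-- The flux `√(-g) ∇^r φ` is `-Σ f sin θ`, with radial derivative `-2mΣ sin θ / (r - Σ)²`. The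
Maxwell source is `-q² sin θ / (r - Σ)²`, and `2mΣ = -q²` balances the two. -/
theorem dilaton_equation_blackHole (hp : p ∈ domain) (hx : x ∈ exterior p) :
    ∑ μ, pd μ (fun y => vol (blackHole p) y * gradDil (blackHole p) y μ) x
      + 1 / 2 * vol (blackHole p) x * Real.exp (-2 * (blackHole p).dil x) *
        Fsq (blackHole p) x = 0 := by
  have h1 := sub_Sig_pos hp hx.1.le
  have h2 := add_Sig_pos hp hx.1.le
  have h3 := Real.exp_pos (p 2)
  have h4 : Real.exp (-2 * (blackHole p).dil x) = _ := exp_dilaton h1 h2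
  have key : ∀ μ : Fin 4, pd μ (fun y => vol (blackHole p) y * gradDil (blackHole p) y μ) x =
      if μ = 1 then -Sig p * (2 * p 0 / (x 1 - Sig p) ^ 2) * Real.sin (x 2) else 0 := by
    intro μ
    have e : (fun y => vol (blackHole p) y * gradDil (blackHole p) y μ) =ᶠ[𝓝 x] fun y =>
        (fun r => if μ = 1 then -Sig p * fBH p r else 0) (y 1) * Real.sin (y 2) := by
      filter_upwards [(isOpen_exterior p).mem_nhds hx] with y hy
      have h1 := sub_Sig_pos hp hy.1.le
      have h2 := add_Sig_pos hp hy.1.le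
      rw [vol_blackHole hp hy, gradDil_blackHole hp hy, areaRadiusSq_eq]
      by_cases h : μ = 1
      · simp only [h, if_true]
        field_simp
      · simp [h]
    rw [pd_congr e, pd_mul_separated (fun r => if μ = 1 then -Sig p * fBH p r else 0)]
    by_cases h : μ = 1
    · simp only [h, if_true, ((hasDerivAt_fBH hp hx.1.le).const_mul (-Sig p)).deriv]
    · simp [h]
  simp only [key, Finset.sum_ite_eq', Finset.mem_univ, if_true]
  rw [vol_blackHole hp hx, h4, Fsq_blackHole hp hx, areaRadiusSq_eq]
  have h5 := two_mul_mass_mul_Sig hp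
  field_simp
  linear_combination -Real.sin (x 2) * h5

theorem ginv_blackHole (hp : p ∈ domain) (hx : x ∈ exterior p) :
    ginv (blackHole p) x = Matrix.diagonal ![-(fBH p (x 1))⁻¹, (1 / fBH p (x 1))⁻¹,
      (areaRadiusSq p (x 1))⁻¹, (areaRadiusSq p (x 1) * Real.sin (x 2) ^ 2)⁻¹] := by
  have ha := (fBH_pos hp hx.1).ne'
  rw [blackHole_eq_static, ginv_static (b := fun r => 1 / fBH p r) ha (one_div_ne_zero ha)
    (areaRadiusSq_pos hp hx.1).ne' (sin_pos_of_mem_exterior hx).ne']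

theorem pd_dil_blackHole (hp : p ∈ domain) (hx : x ∈ exterior p) (μ : Fin 4) :
    pd μ (blackHole p).dil x =
      if μ = 1 then -Sig p / ((x 1 + Sig p) * (x 1 - Sig p)) else 0 := by
  rw [blackHole_eq_static, pd_dil_static,
    (hasDerivAt_dilaton (sub_Sig_pos hp hx.1.le).ne' (add_Sig_pos hp hx.1.le).ne').deriv]

theorem exp_dil_blackHole (hp : p ∈ domain) (hx : x ∈ exterior p) :
    Real.exp (-2 * (blackHole p).dil x) =
      (x 1 - Sig p) / ((x 1 + Sig p) * Real.exp (p 2) ^ 2) :=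
  exp_dilaton (sub_Sig_pos hp hx.1.le) (add_Sig_pos hp hx.1.le)

theorem scalarCurv_blackHole (hp : p ∈ domain) (hx : x ∈ exterior p) :
    scalarCurv (blackHole p) x =
      2 * Sig p ^ 2 * (x 1 - Sig p - 2 * p 0) / ((x 1 + Sig p) ^ 2 * (x 1 - Sig p) ^ 3) := by
  have h1 := sub_Sig_pos hp hx.1.le
  have h2 := add_Sig_pos hp hx.1.le
  have h6 : x 1 - Sig p - 2 * p 0 ≠ 0 := by linarith [two_mul_mass_lt hx.1]
  have hs := (sin_pos_of_mem_exterior hx).ne'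
  simp only [scalarCurv, ginv_blackHole hp hx, Ric_blackHole hp hx, Fin.sum_univ_four, staticRicci]
  simp only [Matrix.diagonal_apply, Fin.reduceEq, if_true, if_false, mul_zero, add_zero, zero_add,
    fBH_eq h2.ne', areaRadiusSq_eq]
  simp only [Matrix.cons_val]
  generalize Real.sin (x 2) = s at *
  field_simp
  ring

/-- On the solution `R = 2 ∇_μφ ∇^μφ`, so only the Maxwell term survives. -/
theorem lagrangian_blackHole (G : ℝ) (hp : p ∈ domain) (hx : x ∈ exterior p) :
    lagrangian G (blackHole p) x = 1 / (16 * Real.pi * G) *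
      (2 * p 1 ^ 2 / ((x 1 + Sig p) * (x 1 - Sig p) ^ 3)) := by
  have h1 := sub_Sig_pos hp hx.1.le
  have h2 := add_Sig_pos hp hx.1.le
  have h3 := Real.exp_pos (p 2)
  simp only [lagrangian, scalarCurv_blackHole hp hx, exp_dil_blackHole hp hx, Fsq_blackHole hp hx,
    gradDil_blackHole hp hx, pd_dil_blackHole hp hx, Fin.sum_univ_four, fBH_eq h2.ne']
  congr 1
  simp only [Fin.reduceEq, if_true, if_false, mul_zero, add_zero, zero_add]
  field_simp
  ring

theorem stress_blackHole (hp : p ∈ domain) (hx : x ∈ exterior p) (μ ν : Fin 4) :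
    ∑ α, ∑ β, ginv (blackHole p) x α β * Fdown (blackHole p) x μ α *
      Fdown (blackHole p) x ν β = if μ = ν then
        ![fBH p (x 1) * ((p 1 * Real.exp (p 2)) ^ 2 / (x 1 - Sig p) ^ 4),
          -(fBH p (x 1))⁻¹ * ((p 1 * Real.exp (p 2)) ^ 2 / (x 1 - Sig p) ^ 4), 0, 0] μ else 0 := by
  have hF := Fdown_static (fBH p) (fun r => 1 / fBH p r) (areaRadiusSq p) (potential p)
    (dilaton p) x
  rw [← blackHole_eq_static, (hasDerivAt_potential (sub_Sig_pos hp hx.1.le).ne').deriv] at hF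
  simp only [ginv_blackHole hp hx, hF, Fin.sum_univ_four]
  generalize x 1 - Sig p = y
  fin_cases μ <;> fin_cases ν <;> simp <;> ring

theorem metric_equation_blackHole (G : ℝ) (hp : p ∈ domain) (hx : x ∈ exterior p)
    (μ ν : Fin 4) :
    1 / (16 * Real.pi * G) * (Ric (blackHole p) x μ ν
      - 2 * Real.exp (-2 * (blackHole p).dil x) * (∑ α, ∑ β, ginv (blackHole p) x α β *
        Fdown (blackHole p) x μ α * Fdown (blackHole p) x ν β)
      - 2 * pd μ (blackHole p).dil x * pd ν (blackHole p).dil x)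
    - 1 / 2 * (blackHole p).g x μ ν * lagrangian G (blackHole p) x = 0 := by
  have h1 := sub_Sig_pos hp hx.1.le
  have h2 := add_Sig_pos hp hx.1.le
  have h3 := Real.exp_pos (p 2)
  have h6 : x 1 - Sig p - 2 * p 0 ≠ 0 := by linarith [two_mul_mass_lt hx.1]
  rw [lagrangian_blackHole G hp hx, stress_blackHole hp hx, Ric_blackHole hp hx,
    exp_dil_blackHole hp hx, pd_dil_blackHole hp hx, pd_dil_blackHole hp hx, mul_left_comm,
    ← mul_sub]
  refine mul_eq_zero_of_right _ ?_
  have hq : p 1 ^ 2 = -(2 * p 0 * Sig p) := by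
    linarith [two_mul_mass_mul_Sig hp]
  have hm : (blackHole p).g x μ ν = _ := Matrix.diagonal_apply _ μ ν
  rw [hm, mul_pow, hq]
  by_cases h : μ = ν
  · subst h
    simp only [if_true, fBH_eq h2.ne', areaRadiusSq_eq, sq_sub_sq]
    generalize Real.exp (p 2) = E at *
    generalize Real.sin (x 2) = s at *
    generalize p 0 = m at *
    -- In `y = r - Σ` and `z = r + Σ` the quantities to be inverted factor into `y`, `z` and `y -
    -- 2m`, all nonzero, and `field_simp` can clear them.
    obtain ⟨y, hy⟩ : ∃ y, y = x 1 - Sig p := ⟨_, rfl⟩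
    obtain ⟨z, hz⟩ : ∃ z, z = x 1 + Sig p := ⟨_, rfl⟩
    have e1 : x 1 = (y + z) / 2 := by linarith
    have e2 : Sig p = (z - y) / 2 := by linarith
    rw [← hy, ← hz, e1, e2]
    rw [← hy] at h1 h6
    rw [← hz] at h2
    clear hm
    fin_cases μ <;> simp [staticRicci] <;> field_simp <;> ring
  · have h' : ¬ (μ = 1 ∧ ν = 1) := fun e => h (e.1.trans e.2.symm)
    rw [if_neg h, if_neg h, if_neg h]
    by_cases h1 : μ = 1
    · have : ν ≠ 1 := fun e => h' ⟨h1, e⟩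
      simp [this]
    · simp [h1]

theorem isSolution_blackHole (G : ℝ) (hp : p ∈ domain) :
    IsSolution G (blackHole p) (exterior p) where
  metric _ hx := metric_equation_blackHole G hp hx
  gauge _ hx := gauge_equation_blackHole hp hx
  dilaton _ hx := dilaton_equation_blackHole hp hx

end EMD

namespace EMD

/-! ## Horizon, asymptotics and symmetries -/

variable {p : Params} {x : Pt}

theorem normSq_blackHole (p : Params) (x : Pt) :
    normSq (blackHole p) (tField 0) x = -fBH p (x 1) := by
  simp [normSq, tField, blackHole, Fin.sum_univ_four]

theorem angVel_blackHole (p : Params) (x : Pt) : angVel (blackHole p) x = 0 := by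
  simp [angVel, blackHole]

theorem elPot_blackHole (p : Params) (x : Pt) :
    elPot (blackHole p) (tField 0) x = potential p (x 1) := by
  simp [elPot, tField, blackHole, potential, Fin.sum_univ_four]

theorem Gam_blackHole (hp : p ∈ domain) (hx : x ∈ exterior p) (μ α β : Fin 4) :
    Gam (blackHole p) x μ α β = christoffelInv (fBH p (x 1)) (areaRadiusSq p (x 1))
      (2 * p 0 / (x 1 - Sig p) ^ 2) (2 * x 1) (Real.sin (x 2)) (Real.cos (x 2)) μ α β := by
  rw [blackHole_eq_static]
  exact Gam_static_inv (a₁ := fun r => 2 * p 0 / (r - Sig p) ^ 2) (c₁ := fun r => 2 * r) _ _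
    (hasDerivAt_fBH hp hx.1.le) (hasDerivAt_areaRadiusSq p _) (fBH_pos hp hx.1).ne'
    (areaRadiusSq_pos hp hx.1).ne' (sin_pos_of_mem_exterior hx).ne' μ α β

theorem covDeriv_const_time (F : Fields) (k : ℝ) (x : Pt) (α β : Fin 4) :
    covDeriv F (fun _ => ![k, 0, 0, 0]) x α β = Gam F x β α 0 * k := by
  simp [covDeriv, pd_const, Fin.sum_univ_four]

theorem tField_zero : tField 0 = fun _ => ![1, 0, 0, 0] := rfl

/-- The expression equals `f'/2` throughout the exterior. The chart metric is singular at `r_+`, so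
the surface gravity is the limit there, where `r - Σ = 2m`. -/
theorem surfGrav_blackHole (hp : p ∈ domain) (hx : x ∈ exterior p) :
    surfGrav (blackHole p) (tField 0) x = p 0 / (x 1 - Sig p) ^ 2 := by
  have ha := (fBH_pos hp hx.1).ne'
  have hg : ∀ i j, (blackHole p).g x i j = _ := Matrix.diagonal_apply _
  rw [surfGrav, ← Real.sqrt_sq (div_pos hp.1 (pow_pos (sub_Sig_pos hp hx.1.le) 2)).le]
  congr 1
  simp only [tField_zero, covDeriv_const_time, Gam_blackHole hp hx, ginv_blackHole hp hx,
    hg, Fin.sum_univ_four]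
  generalize fBH p (x 1) = a at *
  simp [christoffelInv]
  field_simp
  ring

theorem radialLimit_dil (p : Params) : RadialLimit (blackHole p).dil atTop (p 2) := by
  intro t θ φ _ _
  have h : Tendsto (fun r => dilaton p r) atTop (𝓝 (1 / 2 * Real.log 1 + p 2)) := by
    refine ((Tendsto.log ?_ one_ne_zero).const_mul _).add_const _
    have h1 : Tendsto (fun r => 1 + 2 * Sig p / (r - Sig p)) atTop (𝓝 (1 + 0)) :=
      (tendsto_const_nhds.div_atTop (tendsto_atTop_add_const_right _ (-Sig p) tendsto_id)).const_add 1
    rw [add_zero] at h1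
    refine h1.congr' ?_
    filter_upwards [eventually_gt_atTop (Sig p)] with r hr
    have : r - Sig p ≠ 0 := (sub_pos.2 hr).ne'
    field_simp
    ring
  rw [Real.log_one, mul_zero, zero_add] at h
  exact h

theorem radialLimit_normSq (hp : p ∈ domain) :
    RadialLimit (normSq (blackHole p) (tField 0)) (𝓝[>] rplus p) 0 := by
  intro t θ φ _ _
  have h := (hasDerivAt_fBH hp le_rfl).continuousAt.fun_neg.continuousWithinAt (s := Set.Ioi (rplus p))
  have h0 : fBH p (rplus p) = 0 := by simp [fBH]
  simpa [ContinuousWithinAt, normSq_blackHole, h0] using h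

theorem radialLimit_angVel (p : Params) (l : Filter ℝ) :
    RadialLimit (angVel (blackHole p)) l 0 := by
  intro t θ φ _ _
  simpa only [angVel_blackHole] using tendsto_const_nhds

theorem radialLimit_elPot_atTop (p : Params) :
    RadialLimit (elPot (blackHole p) (tField 0)) atTop 0 := by
  intro t θ φ _ _
  simp only [elPot_blackHole]
  exact tendsto_const_nhds.div_atTop (tendsto_atTop_add_const_right _ (-Sig p) tendsto_id)

theorem radialLimit_elPot_horizon (hp : p ∈ domain) :
    RadialLimit (elPot (blackHole p) (tField 0)) (𝓝[>] rplus p) (PhiH p) := by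
  intro t θ φ _ _
  have h := (hasDerivAt_potential (sub_Sig_pos hp le_rfl).ne').continuousAt.continuousWithinAt
    (s := Set.Ioi (rplus p))
  have h0 : potential p (rplus p) = PhiH p := by simp [potential, PhiH, rplus_eq]
  simpa [ContinuousWithinAt, elPot_blackHole, h0] using h

theorem radialLimit_surfGrav (hp : p ∈ domain) :
    RadialLimit (surfGrav (blackHole p) (tField 0)) (𝓝[>] rplus p) (kappaH p) := by
  intro t θ φ h1 h2
  have hy := (sub_Sig_pos hp (le_refl (rplus p))).ne'
  have hm := hp.1.ne'
  have hc : ContinuousAt (fun r => p 0 / (r - Sig p) ^ 2) (rplus p) :=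
    continuousAt_const.div (by fun_prop) (pow_ne_zero 2 hy)
  have h0 : p 0 / (rplus p - Sig p) ^ 2 = kappaH p := by
    rw [rplus_eq, kappaH, add_sub_cancel_right]
    field_simp
    norm_num
  have h : Tendsto (fun r => p 0 / (r - Sig p) ^ 2) (𝓝[>] rplus p) (𝓝 (kappaH p)) :=
    h0 ▸ hc.continuousWithinAt
  refine h.congr' ?_
  filter_upwards [self_mem_nhdsWithin] with r hr
  exact (surfGrav_blackHole (x := ![t, r, θ, φ]) hp ⟨hr, h1, h2⟩).symm

/-- Constant rescalings of `∂_t` and constant gauge parameters are symmetries of every static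
configuration. -/
theorem isExactSymmetry_static (a b c u w : ℝ → ℝ) (k l : ℝ) (U : Set Pt) :
    IsExactSymmetry (staticFields a b c u w) ⟨fun _ => ![k, 0, 0, 0], fun _ => l⟩ U := by
  intro x _
  refine ⟨?_, ?_, ?_⟩
  · ext μ ν
    simp only [gaugeVar, pd_const, pd_static_metric, Matrix.of_apply]
    simp [Fin.sum_univ_four, metricDeriv]
  · ext μ
    simp only [gaugeVar, pd_const]
    have h : pd 0 (fun y => (staticFields a b c u w).A y μ) x = 0 := by
      fin_cases μ
      · simpa [staticFields] using pd_radial u 0 x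
      all_goals simp [staticFields, pd_const]
    simp [Fin.sum_univ_four, h]
  · simp [gaugeVar, pd_dil_static, Fin.sum_univ_four]

/-- This and the next two lemmas bring the generators to the common form `{k ∂_t, l}`. -/
theorem etaM_eq : etaM = ⟨fun _ => ![1, 0, 0, 0], fun _ => 0⟩ := rfl

theorem etaQ_eq : etaQ = ⟨fun _ => ![0, 0, 0, 0], fun _ => 1⟩ := by
  simp only [etaQ, Gen.mk.injEq, and_true]
  funext x i
  fin_cases i <;> rfl

theorem etaS_eq (p : Params) : etaS p = ⟨fun _ => ![2 * Real.pi / kappaH p, 0, 0, 0],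
    fun _ => 2 * Real.pi / kappaH p * -PhiH p⟩ := by
  simp only [etaS, Gen.mk.injEq, and_true]
  funext x i
  fin_cases i <;> simp [tField]

end EMD

namespace EMD

/-! ## The charge-variation form of static fields -/

theorem hasDerivAt_along (a da : ℝ) : HasDerivAt (fun s : ℝ => a + s * da) da 0 := by
  simpa using ((hasDerivAt_id (0 : ℝ)).mul_const da).const_add a

theorem eventually_along_ne {a : ℝ} (ha : a ≠ 0) (da : ℝ) : ∀ᶠ s : ℝ in 𝓝 0, a + s * da ≠ 0 :=
  (hasDerivAt_along a da).continuousAt.eventually_ne (by simpa using ha)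

theorem noether_static (G k l : ℝ) {a b c u w : ℝ → ℝ} {x : Pt} (ha : a (x 1) ≠ 0)
    (hb : b (x 1) ≠ 0) (hc : c (x 1) ≠ 0) (hs : Real.sin (x 2) ≠ 0) :
    noether G ⟨fun _ => ![k, 0, 0, 0], fun _ => l⟩ (staticFields a b c u w) x 0 1 =
      Real.sqrt (a (x 1) * b (x 1) * (c (x 1) * Real.sin (x 2)) ^ 2) / (16 * Real.pi * G) *
        ((k * deriv a (x 1) - 4 * (Real.exp (-2 * w (x 1)) * (deriv u (x 1) *
          (k * u (x 1) + l)))) / (a (x 1) * b (x 1))) := by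
  have hA : ∀ i, (staticFields a b c u w).A x i = ![u (x 1), 0, 0, 0] i := fun _ => rfl
  have hw : (staticFields a b c u w).dil x = w (x 1) := rfl
  simp only [noether, covDeriv_const_time, vol_static, ginv_static ha hb hc hs,
    Gam_static ha hb hc hs, Fup_static ha hb hc hs, Fin.sum_univ_four, hA, hw]
  congr 1
  generalize deriv a (x 1) = a' at *
  generalize a (x 1) = a at *
  generalize b (x 1) = b at *
  simp [christoffel]
  field_simp
  ring

variable {a b c u w da db dc du dw : ℝ → ℝ} {a' c' u' da' dc' du' : ℝ} {x : Pt}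

/-- The radial derivative of `b + s δb` stays unevaluated: it occurs only in `Γ^r_{rr}`, which drops
out of `Θ^r`. -/
theorem Gam_along_static (ha : HasDerivAt a a' (x 1)) (hc : HasDerivAt c c' (x 1))
    (hda : HasDerivAt da da' (x 1)) (hdc : HasDerivAt dc dc' (x 1))
    (ha0 : a (x 1) ≠ 0) (hb0 : b (x 1) ≠ 0) (hc0 : c (x 1) ≠ 0) (hs : Real.sin (x 2) ≠ 0) :
    ∀ᶠ s in 𝓝 0, ∀ μ α β,
      Gam ((staticFields a b c u w).along (staticFields da db dc du dw) s) x μ α β =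
        christoffel (a (x 1) + s * da (x 1)) (b (x 1) + s * db (x 1)) (c (x 1) + s * dc (x 1))
          (a' + s * da') (deriv (fun r => b r + s * db r) (x 1)) (c' + s * dc')
          (Real.sin (x 2)) (Real.cos (x 2)) μ α β := by
  filter_upwards [eventually_along_ne ha0 (da (x 1)), eventually_along_ne hb0 (db (x 1)),
    eventually_along_ne hc0 (dc (x 1))] with s h1 h2 h3 μ α β
  rw [along_static, Gam_static h1 h2 h3 hs, (ha.fun_add (hda.const_mul s)).deriv,
    (hc.fun_add (hdc.const_mul s)).deriv]

theorem Theta_static (G : ℝ) (ha : HasDerivAt a a' (x 1)) (hc : HasDerivAt c c' (x 1))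
    (hda : HasDerivAt da da' (x 1)) (hdc : HasDerivAt dc dc' (x 1))
    (hu : HasDerivAt u u' (x 1)) {w' : ℝ} (hw : HasDerivAt w w' (x 1))
    (ha0 : a (x 1) ≠ 0) (hb : b (x 1) = 1 / a (x 1))
    (hdb : db (x 1) = -da (x 1) / a (x 1) ^ 2) (hc0 : 0 < c (x 1)) (hs : 0 < Real.sin (x 2)) :
    Theta G (staticFields a b c u w) (staticFields da db dc du dw) x 1 =
      c (x 1) * Real.sin (x 2) / (16 * Real.pi * G) *
        (-da' - (2 * a (x 1) * dc' + c' * da (x 1)) / c (x 1)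
          + a (x 1) * c' * dc (x 1) / c (x 1) ^ 2
          + 4 * Real.exp (-2 * w (x 1)) * u' * du (x 1) - 4 * a (x 1) * w' * dw (x 1)) := by
  have hb0 : b (x 1) ≠ 0 := hb ▸ one_div_ne_zero ha0
  have hG := Gam_along_static (u := u) (w := w) (db := db) (du := du) (dw := dw)
    ha hc hda hdc ha0 hb0 hc0.ne' hs.ne'
  have hv : ∀ {μ α β : Fin 4} {φ : ℝ → ℝ} {d : ℝ},
      (∀ s, christoffel (a (x 1) + s * da (x 1)) (b (x 1) + s * db (x 1)) (c (x 1) + s * dc (x 1))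
          (a' + s * da') (deriv (fun r => b r + s * db r) (x 1)) (c' + s * dc')
          (Real.sin (x 2)) (Real.cos (x 2)) μ α β = φ s) →
      HasDerivAt φ d 0 → vary (fun H => Gam H x μ α β) (staticFields a b c u w)
        (staticFields da db dc du dw) = d := by
    intro μ α β φ d h1 h2
    refine (h2.congr_of_eventuallyEq ?_).deriv
    filter_upwards [hG] with s h
    rw [h, h1]
  have hA := hasDerivAt_along (a (x 1)) (da (x 1))
  have hB := hasDerivAt_along (b (x 1)) (db (x 1))
  have hC := hasDerivAt_along (c (x 1)) (dc (x 1))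
  have hA' := hasDerivAt_along a' da'
  have hC' := hasDerivAt_along c' dc'
  have q : ∀ {f h : ℝ → ℝ} {f' h' : ℝ}, HasDerivAt f f' 0 → HasDerivAt h h' 0 → h 0 ≠ 0 →
      HasDerivAt (fun s => f s / (2 * h s)) ((f' * h 0 - f 0 * h') / (2 * h 0 ^ 2)) 0 := by
    intro f h f' h' hf hh h0
    refine (hf.fun_div (hh.const_mul 2) (mul_ne_zero two_ne_zero h0)).congr_deriv ?_
    field_simp
  -- Six variations suffice: in `Θ^r` the two contributions of `δΓ^r_{rr}` cancel, and the other
  -- components meet zeros of the diagonal inverse metric.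
  have v100 := hv (μ := 1) (α := 0) (β := 0) (fun _ => rfl) (q hA' hB (by simpa using hb0))
  have v122 := hv (μ := 1) (α := 2) (β := 2) (fun _ => rfl)
    (q hC'.fun_neg hB (by simpa using hb0))
  have v133 := hv (μ := 1) (α := 3) (β := 3) (fun _ => rfl)
    ((q hC'.fun_neg hB (by simpa using hb0)).mul_const (Real.sin (x 2) ^ 2))
  have v010 := hv (μ := 0) (α := 1) (β := 0) (fun _ => rfl) (q hA' hA (by simpa using ha0))
  have v212 := hv (μ := 2) (α := 1) (β := 2) (fun _ => rfl) (q hC' hC (by simpa using hc0.ne'))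
  have v313 := hv (μ := 3) (α := 1) (β := 3) (fun _ => rfl) (q hC' hC (by simpa using hc0.ne'))
  have hdA : ∀ i, (staticFields da db dc du dw).A x i = ![du (x 1), 0, 0, 0] i := fun _ => rfl
  have hdw : (staticFields da db dc du dw).dil x = dw (x 1) := rfl
  have hw0 : (staticFields a b c u w).dil x = w (x 1) := rfl
  have hvol : vol (staticFields a b c u w) x = c (x 1) * Real.sin (x 2) := by
    rw [vol_static, hb, mul_one_div_cancel ha0, one_mul, Real.sqrt_sq (mul_pos hc0 hs).le]
  simp only [Theta, hvol, ginv_static ha0 hb0 hc0.ne' hs.ne', Fup_static ha0 hb0 hc0.ne' hs.ne',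
    gradDil_static ha0 hb0 hc0.ne' hs.ne', hu.deriv, hw.deriv, Fin.sum_univ_four, hdA, hdw, hw0]
  congr 1
  simp only [Matrix.diagonal_apply, Fin.reduceEq, if_true, if_false, zero_mul, sub_zero, add_zero,
    zero_add, and_true, and_false, mul_zero, Matrix.cons_val]
  rw [v100, v122, v133, v010, v212, v313]
  simp only [zero_mul, add_zero, hb, hdb]
  generalize a (x 1) = A at *
  generalize c (x 1) = C at *
  generalize Real.sin (x 2) = S at *
  clear hv hG v100 v122 v133 v010 v212 v313
  field_simp
  ring

theorem vary_noether_static (G k l : ℝ) (ha : HasDerivAt a a' (x 1))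
    (hda : HasDerivAt da da' (x 1)) (hu : HasDerivAt u u' (x 1)) (hdu : HasDerivAt du du' (x 1))
    (ha0 : a (x 1) ≠ 0) (hb : b (x 1) = 1 / a (x 1))
    (hdb : db (x 1) = -da (x 1) / a (x 1) ^ 2) (hc0 : 0 < c (x 1)) (hs : 0 < Real.sin (x 2)) :
    vary (fun H => noether G ⟨fun _ => ![k, 0, 0, 0], fun _ => l⟩ H x 0 1)
      (staticFields a b c u w) (staticFields da db dc du dw) =
      Real.sin (x 2) / (16 * Real.pi * G) *
        (dc (x 1) * (k * a' - 4 * (Real.exp (-2 * w (x 1)) * (u' * (k * u (x 1) + l))))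
        + c (x 1) * (k * da' - 4 * Real.exp (-2 * w (x 1)) * (du' * (k * u (x 1) + l)
          + u' * k * du (x 1) - 2 * dw (x 1) * u' * (k * u (x 1) + l)))) := by
  have hb0 : b (x 1) ≠ 0 := hb ▸ one_div_ne_zero ha0
  have e : (fun s => noether G ⟨fun _ => ![k, 0, 0, 0], fun _ => l⟩
      ((staticFields a b c u w).along (staticFields da db dc du dw) s) x 0 1) =ᶠ[𝓝 0] fun s =>
      Real.sqrt ((a (x 1) + s * da (x 1)) * (b (x 1) + s * db (x 1)) *
        ((c (x 1) + s * dc (x 1)) * Real.sin (x 2)) ^ 2) / (16 * Real.pi * G) *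
        ((k * (a' + s * da') - 4 * (Real.exp (-2 * (w (x 1) + s * dw (x 1))) * ((u' + s * du') *
          (k * (u (x 1) + s * du (x 1)) + l)))) /
          ((a (x 1) + s * da (x 1)) * (b (x 1) + s * db (x 1)))) := by
    filter_upwards [eventually_along_ne ha0 (da (x 1)), eventually_along_ne hb0 (db (x 1)),
      eventually_along_ne hc0.ne' (dc (x 1))] with s h1 h2 h3
    rw [along_static, noether_static G k l h1 h2 h3 hs.ne', (ha.fun_add (hda.const_mul s)).deriv,
      (hu.fun_add (hdu.const_mul s)).deriv]
  rw [vary, e.deriv_eq]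
  -- By `hb` and `hdb` the product `ab` is `1` with zero first variation, so `√(-g)` varies only
  -- through `c`.
  have hP : HasDerivAt (fun s => (a (x 1) + s * da (x 1)) * (b (x 1) + s * db (x 1))) 0 0 := by
    refine ((hasDerivAt_along _ _).fun_mul (hasDerivAt_along _ _)).congr_deriv ?_
    simp only [zero_mul, add_zero, hb, hdb]
    field_simp
    ring
  have hP0 : (a (x 1) + 0 * da (x 1)) * (b (x 1) + 0 * db (x 1)) = 1 := by
    simp only [zero_mul, add_zero, hb]
    field_simp
  have hQ := ((hasDerivAt_along (c (x 1)) (dc (x 1))).mul_const (Real.sin (x 2))).fun_pow 2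
  have hR : HasDerivAt (fun s => Real.sqrt ((a (x 1) + s * da (x 1)) * (b (x 1) + s * db (x 1)) *
      ((c (x 1) + s * dc (x 1)) * Real.sin (x 2)) ^ 2)) (dc (x 1) * Real.sin (x 2)) 0 := by
    refine ((hP.fun_mul hQ).sqrt ?_).congr_deriv ?_
    · rw [hP0]
      simp only [zero_mul, add_zero]
      positivity
    · simp only [hP0, one_mul]
      simp only [zero_mul, add_zero, zero_add]
      rw [Real.sqrt_sq (mul_pos hc0 hs).le]
      field_simp
      ring
  have hE := ((hasDerivAt_along (w (x 1)) (dw (x 1))).const_mul (-2)).exp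
  have hN := ((hasDerivAt_along a' da').const_mul k).fun_sub ((hE.fun_mul
    ((hasDerivAt_along u' du').fun_mul
      (((hasDerivAt_along (u (x 1)) (du (x 1))).const_mul k).add_const l))).const_mul 4)
  refine ((hR.div_const (16 * Real.pi * G)).fun_mul
    (hN.fun_div hP (hP0 ▸ one_ne_zero))).deriv.trans ?_
  rw [hP0]
  simp only [zero_mul, add_zero, one_mul]
  rw [Real.sqrt_sq (mul_pos hc0 hs).le]
  ring

end EMD

namespace EMD

/-! ## Parametric variations of the black hole -/

variable {p : Params} {r : ℝ}

theorem fderiv_apply_eq_of_line {E : Type*} [NormedAddCommGroup E] [NormedSpace ℝ E] {f : E → ℝ}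
    {p dp : E} {d : ℝ} (hf : DifferentiableAt ℝ f p)
    (h : HasDerivAt (fun s : ℝ => f (p + s • dp)) d 0) : fderiv ℝ f p dp = d := by
  have hl : HasDerivAt (fun s : ℝ => p + s • dp) dp 0 := by
    simpa using ((hasDerivAt_id (0 : ℝ)).smul_const dp).const_add p
  have hf' : HasFDerivAt f (fderiv ℝ f p) (p + (0 : ℝ) • dp) := by
    simpa using hf.hasFDerivAt
  exact (hf'.comp_hasDerivAt 0 hl).unique h

/-- For a differentiable function the sum is the Fréchet derivative at `dp`, so a parametric
variation is a single derivative along the line `p + s dp`. -/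
theorem sum_pd_mul {n : ℕ} {f : (Fin n → ℝ) → ℝ} {p dp : Fin n → ℝ} {d : ℝ}
    (hf : DifferentiableAt ℝ f p) (h : HasDerivAt (fun s : ℝ => f (p + s • dp)) d 0) :
    ∑ i, pd i f p * dp i = d := by
  have h1 : ∀ i, pd i f p = fderiv ℝ f p (Pi.single i 1) := by
    intro i
    have hu := hasDerivAt_update p i (p i)
    have hf' : HasFDerivAt f (fderiv ℝ f p) (Function.update p i (p i)) := by
      simpa using hf.hasFDerivAt
    exact (hf'.comp_hasDerivAt (p i) hu).deriv
  have h3 := LinearMap.pi_apply_eq_sum_univ (fderiv ℝ f p : (Fin n → ℝ) →ₗ[ℝ] ℝ) dp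
  simp only [ContinuousLinearMap.coe_coe, smul_eq_mul] at h3
  rw [← fderiv_apply_eq_of_line hf h, h3]
  refine Finset.sum_congr rfl fun i _ => ?_
  rw [h1, mul_comm]
  congr 2
  ext j
  simp [Pi.single_apply, eq_comm]

/-- `δΣ`. -/
def dSig (p dp : Params) : ℝ := -(p 1 * dp 1) / p 0 + p 1 ^ 2 * dp 0 / (2 * p 0 ^ 2)

theorem hasDerivAt_param (p dp : Params) (i : Fin 3) :
    HasDerivAt (fun s : ℝ => (p + s • dp) i) (dp i) 0 := by
  simpa using hasDerivAt_along (p i) (dp i)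

theorem hasDerivAt_Sig (hp : p 0 ≠ 0) (dp : Params) :
    HasDerivAt (fun s : ℝ => Sig (p + s • dp)) (dSig p dp) 0 := by
  refine (((hasDerivAt_param p dp 1).fun_pow 2).fun_neg.fun_div
    ((hasDerivAt_param p dp 0).const_mul 2) (by simpa using hp)).congr_deriv ?_
  simp [dSig]
  field_simp

theorem differentiableAt_Sig (hp : p 0 ≠ 0) : DifferentiableAt ℝ Sig p := by
  unfold Sig
  fun_prop (disch := simpa using hp)

theorem eventually_add_Sig_ne (hp : p 0 ≠ 0) (hz : r + Sig p ≠ 0) :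
    ∀ᶠ p' in 𝓝 p, r + Sig p' ≠ 0 :=
  ((differentiableAt_Sig hp).continuousAt.const_add r).eventually_ne hz

theorem differentiableAt_fBH (hp : p ∈ domain) (hr : rplus p < r) :
    DifferentiableAt ℝ (fun p' => fBH p' r) p := by
  have hS := differentiableAt_Sig hp.1.ne'
  have hy := (sub_Sig_pos hp hr.le).ne'
  refine DifferentiableAt.congr_of_eventuallyEq
    (f := fun p' : Params => (r - Sig p' - 2 * p' 0) / (r - Sig p')) ?_ ?_
  · fun_prop (disch := assumption)
  · filter_upwards [eventually_add_Sig_ne hp.1.ne' (add_Sig_pos hp hr.le).ne'] with p' h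
    exact fBH_eq h

theorem tendsto_line (p dp : Params) : Tendsto (fun s : ℝ => p + s • dp) (𝓝 0) (𝓝 p) := by
  have : Continuous fun s : ℝ => p + s • dp := by fun_prop
  simpa using this.tendsto 0

theorem hasDerivAt_fBH_param (hp : p ∈ domain) (hr : rplus p < r) (dp : Params) :
    HasDerivAt (fun s : ℝ => fBH (p + s • dp) r)
      (-2 * dp 0 / (r - Sig p) - 2 * p 0 * dSig p dp / (r - Sig p) ^ 2) 0 := by
  have hy := (sub_Sig_pos hp hr.le).ne'
  have hS := (hasDerivAt_Sig hp.1.ne' dp).const_sub r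
  have e : (fun s : ℝ => fBH (p + s • dp) r) =ᶠ[𝓝 0] fun s =>
      (r - Sig (p + s • dp) - 2 * (p + s • dp) 0) / (r - Sig (p + s • dp)) := by
    filter_upwards [(tendsto_line p dp).eventually
      (eventually_add_Sig_ne hp.1.ne' (add_Sig_pos hp hr.le).ne')] with s h
    exact fBH_eq h
  refine (((hS.fun_sub ((hasDerivAt_param p dp 0).const_mul 2)).fun_div hS
    (by simpa using hy)).congr_of_eventuallyEq e).congr_deriv ?_
  simp
  field_simp
  ring

theorem sum_pd_fBH (hp : p ∈ domain) (hr : rplus p < r) (dp : Params) :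
    ∑ i, pd i (fun p' => fBH p' r) p * dp i =
      -2 * dp 0 / (r - Sig p) - 2 * p 0 * dSig p dp / (r - Sig p) ^ 2 :=
  sum_pd_mul (differentiableAt_fBH hp hr) (hasDerivAt_fBH_param hp hr dp)

/-- The linearization of `b = 1/a`, which `Theta_static` and `vary_noether_static` take as `hdb`. -/
theorem sum_pd_inv_fBH (hp : p ∈ domain) (hr : rplus p < r) (dp : Params) :
    ∑ i, pd i (fun p' => 1 / fBH p' r) p * dp i =
      -(∑ i, pd i (fun p' => fBH p' r) p * dp i) / fBH p r ^ 2 := by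
  have ha := (fBH_pos hp hr).ne'
  rw [sum_pd_fBH hp hr]
  refine sum_pd_mul ?_ ?_
  · simpa only [one_div] using (differentiableAt_fBH hp hr).fun_inv ha
  · have := (hasDerivAt_fBH_param hp hr dp).fun_inv (by simpa using ha)
    simpa using this

theorem sum_pd_areaRadiusSq (hp : p ∈ domain) (r : ℝ) (dp : Params) :
    ∑ i, pd i (fun p' => areaRadiusSq p' r) p * dp i = -2 * Sig p * dSig p dp := by
  have hS := differentiableAt_Sig hp.1.ne'
  refine sum_pd_mul ?_ ?_
  · unfold areaRadiusSq
    fun_prop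
  · refine (((hasDerivAt_Sig hp.1.ne' dp).fun_pow 2).const_sub (r ^ 2)).congr_deriv ?_
    simp

theorem sum_pd_potential (hp : p ∈ domain) (hr : rplus p < r) (dp : Params) :
    ∑ i, pd i (fun p' => potential p' r) p * dp i = Real.exp (p 2) *
      ((dp 1 + p 1 * dp 2) / (r - Sig p) + p 1 * dSig p dp / (r - Sig p) ^ 2) := by
  have hS := differentiableAt_Sig hp.1.ne'
  have hy := (sub_Sig_pos hp hr.le).ne'
  refine sum_pd_mul ?_ ?_
  · unfold potential
    fun_prop (disch := assumption)
  · refine (((hasDerivAt_param p dp 1).fun_mul (hasDerivAt_param p dp 2).exp).fun_div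
      ((hasDerivAt_Sig hp.1.ne' dp).const_sub r) (by simpa using hy)).congr_deriv ?_
    simp
    field_simp

theorem sum_pd_dilaton (hp : p ∈ domain) (hr : rplus p < r) (dp : Params) :
    ∑ i, pd i (fun p' => dilaton p' r) p * dp i =
      1 / 2 * (dSig p dp / (r + Sig p) + dSig p dp / (r - Sig p)) + dp 2 := by
  have hS := differentiableAt_Sig hp.1.ne'
  have hy := (sub_Sig_pos hp hr.le).ne'
  have hz := (add_Sig_pos hp hr.le).ne'
  have hq := div_ne_zero hz hy
  refine sum_pd_mul ?_ ?_
  · unfold dilaton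
    fun_prop (disch := assumption)
  · have h := hasDerivAt_Sig hp.1.ne' dp
    refine (((((h.const_add r).fun_div (h.const_sub r) (by simpa using hy)).log
      (by simpa using hq)).const_mul (1 / 2)).fun_add (hasDerivAt_param p dp 2)).congr_deriv ?_
    simp
    field_simp

/-- The angular factor and the sign of `g_{tt}` do not depend on the parameters, so the variation
stays in the ansatz. -/
theorem paramVar_blackHole (p dp : Params) :
    paramVar blackHole p dp = staticFields
      (fun r => ∑ i, pd i (fun p' => fBH p' r) p * dp i)
      (fun r => ∑ i, pd i (fun p' => 1 / fBH p' r) p * dp i)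
      (fun r => ∑ i, pd i (fun p' => areaRadiusSq p' r) p * dp i)
      (fun r => ∑ i, pd i (fun p' => potential p' r) p * dp i)
      (fun r => ∑ i, pd i (fun p' => dilaton p' r) p * dp i) := by
  simp only [paramVar, staticFields, Fields.mk.injEq]
  refine ⟨?_, ?_, rfl⟩
  · funext x
    ext μ ν
    rw [Matrix.of_apply]
    by_cases h : μ = ν
    · subst h
      simp only [Matrix.diagonal_apply_eq, blackHole]
      fin_cases μ
      · simp [pd, Finset.sum_neg_distrib]
      · rfl
      · rfl
      · simp [pd, Finset.sum_mul, areaRadiusSq, mul_right_comm]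
    · simp [blackHole, h, pd_const]
  · funext x μ
    fin_cases μ <;> simp [blackHole, pd_const, potential]

/-! ## The charge variations of the black hole -/

/-- Although `δQ_ε` and `ξ · Θ` both vary with `r`, their combination does not, as expected of an
exact symmetry on shell; hence the charges are the same on every sphere outside the horizon. -/
theorem kform_blackHole (G k l : ℝ) (hG : G ≠ 0) (hp : p ∈ domain) {x : Pt}
    (hx : x ∈ exterior p) (dp : Params) :
    kform G ⟨fun _ => ![k, 0, 0, 0], fun _ => l⟩ (blackHole p) (paramVar blackHole p dp) x 0 1 =
      Real.sin (x 2) * (1 / (4 * Real.pi * G) * (k * (dp 0 - p 1 ^ 2 / (2 * p 0) * dp 2)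
        + l * ((dp 1 - p 1 * dp 2) / Real.exp (p 2)))) := by
  have hy := sub_Sig_pos hp hx.1.le
  have hz := add_Sig_pos hp hx.1.le
  have ha := (fBH_pos hp hx.1).ne'
  have hs := sin_pos_of_mem_exterior hx
  have hc := areaRadiusSq_pos hp hx.1
  have hid := (hasDerivAt_id (x 1)).sub_const (Sig p)
  have hda : HasDerivAt (fun r => ∑ i, pd i (fun p' => fBH p' r) p * dp i)
      (2 * dp 0 / (x 1 - Sig p) ^ 2 + 4 * p 0 * dSig p dp / (x 1 - Sig p) ^ 3) (x 1) := by
    have e : (fun r => ∑ i, pd i (fun p' => fBH p' r) p * dp i) =ᶠ[𝓝 (x 1)] fun r =>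
        -2 * dp 0 / (r - Sig p) - 2 * p 0 * dSig p dp / (r - Sig p) ^ 2 := by
      filter_upwards [lt_mem_nhds hx.1] with r hr
      exact sum_pd_fBH hp hr dp
    refine ((((hasDerivAt_const _ _).fun_div hid hy.ne').fun_sub ((hasDerivAt_const _ _).fun_div
      (hid.fun_pow 2) (pow_ne_zero 2 hy.ne'))).congr_of_eventuallyEq e).congr_deriv ?_
    simp
    field_simp
    ring
  have hdu : HasDerivAt (fun r => ∑ i, pd i (fun p' => potential p' r) p * dp i)
      (-Real.exp (p 2) * ((dp 1 + p 1 * dp 2) / (x 1 - Sig p) ^ 2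
        + 2 * p 1 * dSig p dp / (x 1 - Sig p) ^ 3)) (x 1) := by
    have e : (fun r => ∑ i, pd i (fun p' => potential p' r) p * dp i) =ᶠ[𝓝 (x 1)] fun r =>
        Real.exp (p 2) *
          ((dp 1 + p 1 * dp 2) / (r - Sig p) + p 1 * dSig p dp / (r - Sig p) ^ 2) := by
      filter_upwards [lt_mem_nhds hx.1] with r hr
      exact sum_pd_potential hp hr dp
    refine (((((hasDerivAt_const _ _).fun_div hid hy.ne').fun_add ((hasDerivAt_const _ _).fun_div
      (hid.fun_pow 2) (pow_ne_zero 2 hy.ne'))).const_mul _).congr_of_eventuallyEq e).congr_deriv ?_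
    simp
    field_simp
    ring
  have hdc : HasDerivAt (fun r => ∑ i, pd i (fun p' => areaRadiusSq p' r) p * dp i) 0 (x 1) := by
    simp only [sum_pd_areaRadiusSq hp]
    exact hasDerivAt_const _ _
  have hdb := sum_pd_inv_fBH hp hx.1 dp
  rw [kform, paramVar_blackHole, blackHole_eq_static,
    vary_noether_static (b := fun r => 1 / fBH p r) G k l (hasDerivAt_fBH hp hx.1.le) hda
      (hasDerivAt_potential hy.ne') hdu ha rfl hdb hc hs,
    Theta_static (b := fun r => 1 / fBH p r) G (hasDerivAt_fBH hp hx.1.le)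
      (hasDerivAt_areaRadiusSq p _) hda hdc (hasDerivAt_potential hy.ne')
      (hasDerivAt_dilaton hy.ne' hz.ne') ha rfl hdb hc hs, exp_dilaton hy hz,
    sum_pd_fBH hp hx.1, sum_pd_areaRadiusSq hp, sum_pd_potential hp hx.1, sum_pd_dilaton hp hx.1,
    fBH_eq hz.ne', areaRadiusSq_eq]
  simp only [Matrix.cons_val, zero_mul, sub_zero, potential]
  have h1 := two_mul_mass_mul_Sig hp
  -- Half the variation of `2mΣ = -q²`.
  have h2 : p 0 * dSig p dp + Sig p * dp 0 = -(p 1 * dp 1) := by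
    have := hp.1.ne'
    simp only [dSig, Sig]
    field_simp
    ring
  have hE := Real.exp_pos (p 2)
  have hm := hp.1
  have hπ := Real.pi_pos
  generalize Real.exp (p 2) = E at *
  generalize Real.sin (x 2) = S at *
  generalize Real.pi = π at *
  generalize dSig p dp = σ at *
  clear hda hdu hdc hdb
  obtain ⟨y, hy'⟩ : ∃ y, y = x 1 - Sig p := ⟨_, rfl⟩
  obtain ⟨z, hz'⟩ : ∃ z, z = x 1 + Sig p := ⟨_, rfl⟩
  have e1 : x 1 = (y + z) / 2 := by linarith
  have e2 : Sig p = (z - y) / 2 := by linarith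
  rw [← hy', ← hz', e1, e2]
  rw [← hy'] at hy
  rw [← hz'] at hz
  rw [e2] at h1 h2
  clear hid
  generalize p 0 = m at *
  generalize p 1 = q at *
  generalize dp 0 = dm at *
  generalize dp 1 = dq at *
  generalize dp 2 = dφ at *
  field_simp
  -- Only the `k` part needs the two relations; the `l` part is a polynomial identity.
  linear_combination k * E * ((32 * z * y ^ 2 * dφ - 64 * m * z * y * dφ) * h1
    + 64 * m * z * y * h2)

end EMD

namespace EMD

variable {p : Params}

theorem chargeVar_blackHole {G : ℝ} (hG : G ≠ 0) (k l t : ℝ) (hp : p ∈ domain) {r : ℝ}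
    (hr : rplus p < r) (dp : Params) :
    chargeVar G ⟨fun _ => ![k, 0, 0, 0], fun _ => l⟩ (blackHole p) (paramVar blackHole p dp) t r =
      (k * (dp 0 - p 1 ^ 2 / (2 * p 0) * dp 2)
        + l * ((dp 1 - p 1 * dp 2) / Real.exp (p 2))) / G := by
  -- The formula for the integrand is available only for `0 < θ < π`: the chart degenerates at the
  -- poles, which the integral ignores.
  rw [chargeVar, intervalIntegral.integral_congr_Ioo_of_le Real.pi_pos.le
    (g := fun θ => Real.sin θ * (2 * Real.pi * (1 / (4 * Real.pi * G) *
      (k * (dp 0 - p 1 ^ 2 / (2 * p 0) * dp 2)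
        + l * ((dp 1 - p 1 * dp 2) / Real.exp (p 2))))))]
  · rw [intervalIntegral.integral_mul_const, integral_sin, Real.cos_zero, Real.cos_pi]
    have := Real.pi_pos
    field_simp
    ring
  · intro θ hθ
    have h : ∀ φ, kform G ⟨fun _ => ![k, 0, 0, 0], fun _ => l⟩ (blackHole p)
        (paramVar blackHole p dp) ![t, r, θ, φ] 0 1 = _ := fun φ =>
      kform_blackHole G k l hG hp (x := ![t, r, θ, φ]) ⟨hr, hθ.1, hθ.2⟩ dp
    simp only [h, intervalIntegral.integral_const, smul_eq_mul, Matrix.cons_val]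
    ring

theorem massVar_eq {G : ℝ} (hG : G ≠ 0) (t : ℝ) {ρ : Params → ℝ} (hp : p ∈ domain)
    (hρ : rplus p < ρ p) (dp : Params) :
    bhChargeVar G (fun _ => etaM) t ρ p dp = dp 0 / G - p 1 ^ 2 / (2 * G * p 0) * dp 2 := by
  have := hp.1
  rw [bhChargeVar, etaM_eq, chargeVar_blackHole hG _ _ _ hp hρ]
  field_simp
  ring

theorem elChargeVar_eq {G : ℝ} (hG : G ≠ 0) (t : ℝ) {ρ : Params → ℝ} (hp : p ∈ domain)
    (hρ : rplus p < ρ p) (dp : Params) :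
    bhChargeVar G (fun _ => etaQ) t ρ p dp = Real.exp (-p 2) / G * (dp 1 - p 1 * dp 2) := by
  rw [bhChargeVar, etaQ_eq, chargeVar_blackHole hG _ _ _ hp hρ, Real.exp_neg]
  ring

theorem entropyVar_eq {G : ℝ} (hG : G ≠ 0) (t : ℝ) {ρ : Params → ℝ} (hp : p ∈ domain)
    (hρ : rplus p < ρ p) (dp : Params) :
    bhChargeVar G etaS t ρ p dp =
      8 * Real.pi * p 0 / G * dp 0 - 4 * Real.pi * p 1 / G * dp 1 := by
  have := hp.1
  have := Real.exp_pos (p 2)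
  rw [bhChargeVar, etaS_eq, chargeVar_blackHole hG _ _ _ hp hρ, kappaH, PhiH]
  field_simp
  ring

/-! ## Integrability -/

variable {V : Submodule ℝ Params} {U : Set Params} {dH : Params → Params → ℝ} {H : Params → ℝ}

theorem Integrates.mono {V' : Submodule ℝ Params} {U' : Set Params} (h : Integrates V U dH H)
    (hV : V' ≤ V) (hU : U' ⊆ U) : Integrates V' U' dH H := by
  intro p hp
  obtain ⟨L, hL, hd⟩ := h p (hU hp)
  let ι : V' →L[ℝ] V := LinearMap.toContinuousLinearMap (Submodule.inclusion hV)
  refine ⟨L.comp ι, fun v => hL (ι v), ?_⟩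
  have hd' : HasFDerivAt (fun v : V => H (p + (v : Params))) L (ι 0) := by simpa using hd
  exact hd'.comp 0 ι.hasFDerivAt

theorem integrates_of_fderiv (hd : ∀ p ∈ U, DifferentiableAt ℝ H p)
    (h : ∀ p ∈ U, ∀ v ∈ V, fderiv ℝ H p v = dH p v) : Integrates V U dH H := by
  intro p hp
  refine ⟨(fderiv ℝ H p).comp V.subtypeL, fun v => h p hp v v.2, ?_⟩
  have hd' : HasFDerivAt H (fderiv ℝ H p) (p + ((0 : V) : Params)) := by
    simpa using (hd p hp).hasFDerivAt
  exact HasFDerivAt.comp (f := fun v : V => p + (v : Params)) 0 hd'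
    (V.subtypeL.hasFDerivAt.const_add p)

theorem Integrates.hasDerivAt (h : Integrates V U dH H) {v : Params} (hv : v ∈ V) {s : ℝ}
    (hp : p + s • v ∈ U) : HasDerivAt (fun s : ℝ => H (p + s • v)) (dH (p + s • v) v) s := by
  obtain ⟨L, hL, hd⟩ := h _ hp
  -- The definition gives a derivative only at the origin of a translate, so the line is recentred
  -- at its point of parameter `s`.
  have hl : HasDerivAt (fun σ : ℝ => (σ - s) • (⟨v, hv⟩ : V)) ⟨v, hv⟩ s := by
    simpa using ((hasDerivAt_id s).sub_const s).smul_const (⟨v, hv⟩ : V)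
  have hd' : HasFDerivAt (fun w : V => H (p + s • v + (w : Params))) L
      ((s - s) • (⟨v, hv⟩ : V)) := by simpa using hd
  have := hd'.comp_hasDerivAt s hl
  rw [hL] at this
  refine this.congr_of_eventuallyEq (.of_forall fun σ => ?_)
  simp only [Function.comp_apply, Submodule.coe_smul]
  congr 1
  module

/-- If an integrable one-form is constant in the direction `w`, then its other components do not
change along `w`. -/
theorem Integrates.eventually_eq (h : Integrates V U dH H) (hU : IsOpen U) {v w : Params}
    (hv : v ∈ V) (hw : w ∈ V) {k : ℝ} (hk : ∀ p ∈ U, dH p w = k) (hp : p ∈ U) :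
    ∀ᶠ s : ℝ in 𝓝 0, dH (p + s • w) v = dH p v := by
  have hc : Continuous fun z : ℝ × ℝ => p + z.2 • v + z.1 • w := by fun_prop
  obtain ⟨ε, hε, hsub⟩ := Metric.isOpen_iff.1 (hU.preimage hc) (0, 0) (by simpa using hp)
  have hmem : ∀ s ∈ Metric.ball (0 : ℝ) ε, ∀ τ ∈ Metric.ball (0 : ℝ) ε,
      p + τ • v + s • w ∈ U := by
    intro s hs τ hτ
    have hz : (s, τ) ∈ Metric.ball ((0 : ℝ), (0 : ℝ)) ε := by
      rw [← ball_prod_same]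
      exact ⟨hs, hτ⟩
    exact hsub hz
  have h0 : (0 : ℝ) ∈ Metric.ball (0 : ℝ) ε := Metric.mem_ball_self hε
  -- `H` is affine in the direction `w` with slope `k`, at every offset `τ v`. Differentiating this
  -- in `τ` at zero compares the `v` components without a second derivative of `H`.
  have hconst : ∀ s ∈ Metric.ball (0 : ℝ) ε, ∀ τ ∈ Metric.ball (0 : ℝ) ε,
      H (p + τ • v + s • w) = H (p + τ • v) + s * k := by
    intro s hs τ hτ
    have hd : ∀ σ ∈ Metric.ball (0 : ℝ) ε,
        HasDerivAt (fun σ : ℝ => H (p + τ • v + σ • w) - σ * k) 0 σ := by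
      intro σ hσ
      have := (h.hasDerivAt hw (hmem σ hσ τ hτ)).fun_sub ((hasDerivAt_id σ).mul_const k)
      rw [hk _ (hmem σ hσ τ hτ), one_mul, sub_self] at this
      exact this
    have := Metric.isOpen_ball.is_const_of_deriv_eq_zero
      (convex_ball (0 : ℝ) ε).isPreconnected
      (fun σ hσ => (hd σ hσ).differentiableAt.differentiableWithinAt)
      (fun σ hσ => (hd σ hσ).deriv) hs h0
    simp only [zero_smul, add_zero, zero_mul, sub_zero] at this
    linarith
  filter_upwards [Metric.ball_mem_nhds 0 hε] with s hs
  have h1 : HasDerivAt (fun τ : ℝ => H (p + s • w + τ • v)) (dH (p + s • w) v) 0 := by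
    have := h.hasDerivAt (p := p + s • w) (s := 0) hv (by simpa using hmem s hs 0 h0)
    simpa using this
  have h2 : HasDerivAt (fun τ : ℝ => H (p + τ • v) + s * k) (dH p v) 0 := by
    have := h.hasDerivAt (p := p) (s := 0) hv (by simpa using hp)
    simpa using this.add_const (s * k)
  refine h1.unique (h2.congr_of_eventuallyEq ?_)
  filter_upwards [Metric.ball_mem_nhds 0 hε] with τ hτ
  rw [add_right_comm, hconst s hs τ hτ]

theorem exists_ne_zero_of_two_le_finrank (hV : 2 ≤ Module.finrank ℝ V) (i : Fin 3) :
    ∃ w ∈ V, w ≠ 0 ∧ w i = 0 := by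
  let f : V →ₗ[ℝ] ℝ := (LinearMap.proj (R := ℝ) (φ := fun _ : Fin 3 => ℝ) i).domRestrict V
  have hf : ¬ Function.Injective f := fun h => by
    have := LinearMap.finrank_le_finrank_of_injective h
    rw [Module.finrank_self] at this
    omega
  rw [← LinearMap.ker_eq_bot, Submodule.eq_bot_iff] at hf
  push Not at hf
  obtain ⟨w, hw, h0⟩ := hf
  exact ⟨w, w.2, by simpa using h0, hw⟩

theorem two_le_finrank_frozen (i : Fin 3) : 2 ≤ Module.finrank ℝ (frozen i) := by
  have h := LinearMap.finrank_range_add_finrank_ker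
    (LinearMap.proj (R := ℝ) (φ := fun _ : Fin 3 => ℝ) i)
  have h1 := (LinearMap.range (LinearMap.proj (R := ℝ) (φ := fun _ : Fin 3 => ℝ) i)).finrank_le
  rw [Module.finrank_self] at h1
  rw [Module.finrank_fin_fun] at h
  have h2 : 2 ≤ Module.finrank ℝ
      (LinearMap.ker (LinearMap.proj (R := ℝ) (φ := fun _ : Fin 3 => ℝ) i)) := by omega
  exact h2

/-- A one-form `(δm - q²/(2m) δφ_∞) / G` is not integrable on an open set of black holes in two or
more directions along which `φ_∞` varies. -/
theorem not_isIntegrable_mass {G : ℝ} (hG : G ≠ 0) (hU : IsOpen U) (hne : U.Nonempty)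
    (hsub : U ⊆ domain)
    (hM : ∀ p ∈ domain, ∀ v : Params, dH p v = v 0 / G - p 1 ^ 2 / (2 * G * p 0) * v 2)
    (hV : 2 ≤ Module.finrank ℝ V) {v : Params} (hv : v ∈ V) (hv2 : v 2 ≠ 0) :
    ¬ IsIntegrable V U dH := by
  rintro ⟨H, hH⟩
  obtain ⟨w, hw, hw0, hw2⟩ := exists_ne_zero_of_two_le_finrank hV 2
  have hk : ∀ p ∈ U, dH p w = w 0 / G := fun p hp => by rw [hM p (hsub hp), hw2]; simp
  -- The `v` component varies with `p` only through `v 2 * q²/m`, so the derivative of `q²/m` along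
  -- `w` vanishes.
  have key : ∀ p ∈ U, 2 * p 1 * w 1 * p 0 - p 1 ^ 2 * w 0 = 0 := by
    intro p hp
    have hm := (hsub hp).1.ne'
    have e := hH.eventually_eq hU hv hw hk hp
    have hmem : ∀ᶠ s : ℝ in 𝓝 0, p + s • w ∈ U :=
      (tendsto_line p w).eventually (hU.mem_nhds hp)
    have hd := ((hasDerivAt_along (p 1) (w 1)).fun_pow 2).fun_div
      (hasDerivAt_along (p 0) (w 0)) (by simpa using hm)
    have hd0 : HasDerivAt (fun s : ℝ => (p 1 + s * w 1) ^ 2 / (p 0 + s * w 0)) 0 0 := by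
      refine (hasDerivAt_const 0 (p 1 ^ 2 / p 0)).congr_of_eventuallyEq ?_
      filter_upwards [e, hmem] with s hs hs'
      rw [hM _ (hsub hs'), hM _ (hsub hp)] at hs
      have hm' := (hsub hs').1.ne'
      simp only [Pi.add_apply, Pi.smul_apply, smul_eq_mul] at hs hm'
      field_simp at hs ⊢
      exact mul_left_cancel₀ hv2 (by linear_combination -hs)
    have := hd.unique hd0
    simp only [zero_mul, add_zero] at this
    field_simp at this
    simpa using this
  obtain ⟨p, hp⟩ := hne
  -- At `q = 0` the condition `key` is empty, so `q` is varied. The result is a quadratic in `s`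
  -- vanishing at `0` and `±ε/2`: its second difference gives `w 0 = 0`, then its first difference
  -- gives `w 1 = 0`.
  have hc := (tendsto_line p (Pi.single 1 1)).eventually (hU.mem_nhds hp)
  obtain ⟨ε, hε, hb⟩ := Metric.eventually_nhds_iff.1 hc
  have hq : ∀ s : ℝ, |s| < ε → 2 * (p 1 + s) * w 1 * p 0 - (p 1 + s) ^ 2 * w 0 = 0 := by
    intro s hs
    simpa using key _ (hb (y := s) (by simpa using hs))
  have q0 := hq 0 (by simpa using hε)
  have q1 := hq (ε / 2) (by rw [abs_of_pos (half_pos hε)]; exact half_lt_self hε)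
  have q2 := hq (-(ε / 2)) (by rw [abs_neg, abs_of_pos (half_pos hε)]; exact half_lt_self hε)
  have hw00 : w 0 = 0 := by
    have : ε ^ 2 * w 0 = 0 := by linear_combination 4 * q0 - 2 * q1 - 2 * q2
    exact (mul_eq_zero.1 this).resolve_left (pow_ne_zero 2 hε.ne')
  have hw1 : w 1 = 0 := by
    have : ε * p 0 * w 1 = 0 := by
      rw [hw00] at q0 q1
      linear_combination q1 - q0
    exact (mul_eq_zero.1 this).resolve_left (mul_ne_zero hε.ne' (hsub hp).1.ne')
  refine hw0 (funext fun i => ?_)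
  fin_cases i
  · exact hw00
  · exact hw1
  · exact hw2

/-! ## The integrated charges -/

theorem fderiv_massCharge (G : ℝ) (p dp : Params) :
    fderiv ℝ (massCharge G) p dp = dp 0 / G :=
  fderiv_apply_eq_of_line (by unfold massCharge; fun_prop)
    ((hasDerivAt_param p dp 0).div_const G)

theorem fderiv_elCharge (G : ℝ) (p dp : Params) :
    fderiv ℝ (elCharge G) p dp = Real.exp (-p 2) / G * (dp 1 - p 1 * dp 2) := by
  refine fderiv_apply_eq_of_line (by unfold elCharge; fun_prop)
    ((((hasDerivAt_param p dp 1).fun_mul (hasDerivAt_param p dp 2).fun_neg.exp).div_const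
      G).congr_deriv ?_)
  simp
  ring

theorem fderiv_entropyCharge (G : ℝ) (p dp : Params) :
    fderiv ℝ (entropyCharge G) p dp =
      8 * Real.pi * p 0 / G * dp 0 - 4 * Real.pi * p 1 / G * dp 1 := by
  refine fderiv_apply_eq_of_line (by unfold entropyCharge; fun_prop)
    ((((((hasDerivAt_param p dp 0).fun_pow 2).const_mul 4).fun_sub
      (((hasDerivAt_param p dp 1).fun_pow 2).const_mul 2)).const_mul Real.pi).div_const
        G |>.congr_deriv ?_)
  simp
  ring

/-- The `δφ_∞` terms cancel because `Φ_H q e^{-φ_∞} = q²/(2m)`. -/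
theorem first_law {G : ℝ} (hG : G ≠ 0) (hp : p ∈ domain) (dp : Params) :
    kappaH p / (2 * Real.pi) *
        (8 * Real.pi * p 0 / G * dp 0 - 4 * Real.pi * p 1 / G * dp 1) =
      dp 0 / G - p 1 ^ 2 / (2 * G * p 0) * dp 2
        - PhiH p * (Real.exp (-p 2) / G * (dp 1 - p 1 * dp 2)) := by
  have := hp.1
  have := Real.exp_pos (p 2)
  have := Real.pi_pos
  rw [kappaH, PhiH, Real.exp_neg]
  field_simp
  ring

end EMD

end

/-! ### Charges, integrability and the first law -/

theorem mainTheorem3 (G : ℝ) (hG : 0 < G) :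
    -- the black holes are solutions, `r = r_+` is their horizon, and the potentials are as stated
    (∀ p ∈ EMD.domain,
      EMD.IsSolution G (EMD.blackHole p) (EMD.exterior p) ∧
      EMD.RadialLimit (EMD.blackHole p).dil atTop (p 2) ∧
      (∀ x ∈ EMD.exterior p, EMD.normSq (EMD.blackHole p) (EMD.tField 0) x < 0) ∧
      EMD.RadialLimit (EMD.normSq (EMD.blackHole p) (EMD.tField 0)) (𝓝[>] EMD.rplus p) 0 ∧
      EMD.RadialLimit (EMD.angVel (EMD.blackHole p)) (𝓝[>] EMD.rplus p) 0 ∧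
      EMD.RadialLimit (EMD.angVel (EMD.blackHole p)) atTop 0 ∧
      EMD.RadialLimit (EMD.elPot (EMD.blackHole p) (EMD.tField 0)) atTop 0 ∧
      EMD.RadialLimit (EMD.elPot (EMD.blackHole p) (EMD.tField 0)) (𝓝[>] EMD.rplus p)
        (EMD.PhiH p) ∧
      EMD.RadialLimit (EMD.surfGrav (EMD.blackHole p) (EMD.tField 0)) (𝓝[>] EMD.rplus p)
        (EMD.kappaH p) ∧
      EMD.IsExactSymmetry (EMD.blackHole p) EMD.etaM (EMD.exterior p) ∧
      EMD.IsExactSymmetry (EMD.blackHole p) EMD.etaQ (EMD.exterior p) ∧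
      EMD.IsExactSymmetry (EMD.blackHole p) (EMD.etaS p) (EMD.exterior p)) ∧
    -- charge variations, computed on arbitrary spheres outside the horizon
    ∀ (t : ℝ) (ρ : EMD.Params → ℝ), (∀ p ∈ EMD.domain, EMD.rplus p < ρ p) →
    ∀ δM δQ δS : EMD.Params → EMD.Params → ℝ,
      δM = EMD.bhChargeVar G (fun _ => EMD.etaM) t ρ →
      δQ = EMD.bhChargeVar G (fun _ => EMD.etaQ) t ρ →
      δS = EMD.bhChargeVar G EMD.etaS t ρ →
      -- the parametric variations
      (∀ p ∈ EMD.domain, ∀ δp : EMD.Params,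
        δM p δp = δp 0 / G - p 1 ^ 2 / (2 * G * p 0) * δp 2 ∧
        δQ p δp = Real.exp (-p 2) / G * (δp 1 - p 1 * δp 2) ∧
        δS p δp = 8 * Real.pi * p 0 / G * δp 0 - 4 * Real.pi * p 1 / G * δp 1) ∧
      -- for independent variations, mass is integrable exactly when `δφ_∞ = 0`
      (∀ U : Set EMD.Params, IsOpen U → U.Nonempty → U ⊆ EMD.domain →
        (∀ V : Submodule ℝ EMD.Params, 2 ≤ Module.finrank ℝ V →
          (EMD.IsIntegrable V U δM ↔ ∀ v ∈ V, v 2 = 0)) ∧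
        -- of the three parameters exactly `φ_∞` is redundant
        (∀ i : Fin 3, EMD.IsRedundant U ![δM, δQ, δS] i ↔ i = 2)) ∧
      -- the integrated charges
      EMD.Integrates (EMD.frozen 2) EMD.domain δM (EMD.massCharge G) ∧
      EMD.Integrates ⊤ EMD.domain δQ (EMD.elCharge G) ∧
      EMD.Integrates ⊤ EMD.domain δS (EMD.entropyCharge G) ∧
      -- the first law for the variations, and for the integrated charges with `δφ_∞ = 0`
      (∀ p ∈ EMD.domain, ∀ δp : EMD.Params,
        EMD.kappaH p / (2 * Real.pi) * δS p δp = δM p δp - EMD.PhiH p * δQ p δp) ∧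
      (∀ p ∈ EMD.domain, ∀ δp : EMD.Params, δp 2 = 0 →
        EMD.kappaH p / (2 * Real.pi) * fderiv ℝ (EMD.entropyCharge G) p δp =
          fderiv ℝ (EMD.massCharge G) p δp
            - EMD.PhiH p * fderiv ℝ (EMD.elCharge G) p δp) := by
  have hG0 := hG.ne'
  refine ⟨fun p hp => ⟨EMD.isSolution_blackHole G hp, EMD.radialLimit_dil p, fun x hx => ?_,
    EMD.radialLimit_normSq hp, EMD.radialLimit_angVel p _, EMD.radialLimit_angVel p _,
    EMD.radialLimit_elPot_atTop p, EMD.radialLimit_elPot_horizon hp, EMD.radialLimit_surfGrav hp,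
    ?_, ?_, ?_⟩, ?_⟩
  · rw [EMD.normSq_blackHole]
    exact neg_neg_of_pos (EMD.fBH_pos hp hx.1)
  · rw [EMD.etaM_eq, EMD.blackHole_eq_static]
    exact EMD.isExactSymmetry_static _ _ _ _ _ _ _ _
  · rw [EMD.etaQ_eq, EMD.blackHole_eq_static]
    exact EMD.isExactSymmetry_static _ _ _ _ _ _ _ _
  · rw [EMD.etaS_eq, EMD.blackHole_eq_static]
    exact EMD.isExactSymmetry_static _ _ _ _ _ _ _ _
  intro t ρ hρ δM δQ δS hδM hδQ hδS
  have hM : ∀ p ∈ EMD.domain, ∀ v : EMD.Params,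
      δM p v = v 0 / G - p 1 ^ 2 / (2 * G * p 0) * v 2 := fun p hp v => by
    rw [hδM, EMD.massVar_eq hG0 t hp (hρ p hp)]
  have hQ : ∀ p ∈ EMD.domain, ∀ v : EMD.Params,
      δQ p v = Real.exp (-p 2) / G * (v 1 - p 1 * v 2) := fun p hp v => by
    rw [hδQ, EMD.elChargeVar_eq hG0 t hp (hρ p hp)]
  have hS : ∀ p ∈ EMD.domain, ∀ v : EMD.Params,
      δS p v = 8 * Real.pi * p 0 / G * v 0 - 4 * Real.pi * p 1 / G * v 1 := fun p hp v => by
    rw [hδS, EMD.entropyVar_eq hG0 t hp (hρ p hp)]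
  have intM : EMD.Integrates (EMD.frozen 2) EMD.domain δM (EMD.massCharge G) :=
    EMD.integrates_of_fderiv (fun p _ => by unfold EMD.massCharge; fun_prop) fun p hp v hv => by
      have hv2 : v 2 = 0 := hv
      rw [EMD.fderiv_massCharge, hM p hp, hv2, mul_zero, sub_zero]
  have intQ : EMD.Integrates ⊤ EMD.domain δQ (EMD.elCharge G) :=
    EMD.integrates_of_fderiv (fun p _ => by unfold EMD.elCharge; fun_prop) fun p hp v _ => by
      rw [EMD.fderiv_elCharge, hQ p hp]
  have intS : EMD.Integrates ⊤ EMD.domain δS (EMD.entropyCharge G) :=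
    EMD.integrates_of_fderiv (fun p _ => by unfold EMD.entropyCharge; fun_prop) fun p hp v _ => by
      rw [EMD.fderiv_entropyCharge, hS p hp]
  refine ⟨fun p hp v => ⟨hM p hp v, hQ p hp v, hS p hp v⟩, fun U hU hne hsub => ?_, intM, intQ,
    intS, fun p hp v => ?_, fun p hp v hv => ?_⟩
  · have hiff : ∀ V : Submodule ℝ EMD.Params, 2 ≤ Module.finrank ℝ V →
        (EMD.IsIntegrable V U δM ↔ ∀ v ∈ V, v 2 = 0) := by
      refine fun V hV => ⟨fun h v hv => ?_, fun h => ⟨_, intM.mono (fun v hv => h v hv) hsub⟩⟩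
      by_contra hv2
      exact EMD.not_isIntegrable_mass hG0 hU hne hsub hM hV hv hv2 h
    refine ⟨hiff, fun i => ⟨fun h => ?_, ?_⟩⟩
    · by_contra hi
      -- Freezing a parameter other than `φ_∞` leaves a plane containing the `φ_∞` direction, on
      -- which the mass (index `0`) is not integrable.
      have h2 := (hiff _ (EMD.two_le_finrank_frozen i)).1 (h.2 0) (Pi.single 2 1)
        (Pi.single_eq_of_ne hi 1)
      simp at h2
    · rintro rfl
      refine ⟨⟨0, fun h => ?_⟩, fun j => ?_⟩
      · have h2 := (hiff ⊤ (by simp)).1 h (Pi.single 2 1) trivial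
        simp at h2
      · fin_cases j
        · exact ⟨_, intM.mono le_rfl hsub⟩
        · exact ⟨_, intQ.mono le_top hsub⟩
        · exact ⟨_, intS.mono le_top hsub⟩
  · rw [hM p hp, hQ p hp, hS p hp]
    exact EMD.first_law hG0 hp v
  · rw [EMD.fderiv_massCharge, EMD.fderiv_elCharge, EMD.fderiv_entropyCharge,
      EMD.first_law hG0 hp v, hv, mul_zero, sub_zero]
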